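/- **Setting.** Let $D\subset\mathbb R^d$ (space) and $R\subset\mathbb R^m$ (parameters of the rays $r=$ (direction, frequency)) be Peano–Jordan measurable, let $\Omega(r)\in\mathbb R^d\setminus\{0\}$ be the direction of $r\in R$, $\chi>0$ the extinction coefficient on $D\times R$, $\sigma\ge 0$ the scattering coefficient on $D$, $s_d>0$, $\gamma=\sigma/(s_d\chi)$, and let the scattering kernel $\Phi(x,r,r')$ be bounded on $D\times R\times R$ and Riemann integrable in $(r,r')$ for every $x\in D$. (Plane-parallel problem: $d=1$, $r=(\mu,\nu)$, $\Omega(r)=\mu\ne0$, $s_d=2$, $\gamma=\sigma/2\chi$.) A discretization consists of spatial nodes $x_1,\dots,x_{N_s}\in D$, rays $r_1,\dots,r_{N_r}\in R$ and weights $w_1,\dots,w_{N_r}\in\mathbb R$; put $N=N_sN_r$. The $k$-th ray has $L_k$ parallel characteristics in $D$, the $\ell$-th one carrying ordered nodes $1,\dots,M$, $M=M_{k,\ell}$, with optical steps $\Delta\tau_i=\int\chi(\cdot,r_k)\,ds>0$ between the nodes $i$ and $i+1$ ($\chi(\cdot,r_k)$ being integrable there; the path is parametrized with velocity $\pm\Omega(r_k)$).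 Its implicit Euler transfer matrix is $M\times M$: it has the entries $$f_{i,j}=\Delta\tau_{j-1}\prod_{l=j}^{i}(1+\Delta\tau_{l-1})^{-1}\quad(2\le j\le i\le M)$$ if radiation propagates towards increasing indices, and $$h_{i,j}=\Delta\tau_j\prod_{l=i}^{j}(1+\Delta\tau_l)^{-1}\quad(1\le i\le j\le M-1)$$ if it propagates towards decreasing indices; all other entries vanish. $\Lambda_{[k]}=T_{RC,k}\,\Lambda_{R,k}\,T_{CR,k}\in\mathbb R^{N_s\times N_s}$, where $\Lambda_{R,k}$ is block diagonal with these $L_k$ blocks and $T_{CR,k}$, $T_{RC,k}$ interpolate from the spatial nodes to the nodes of the characteristics and back. (Plane-parallel: $L_k=1$, both interpolations are the identity, propagation is towards increasing optical depth for $\mu<0$ and decreasing for $\mu>0$.) $\Lambda_N$ is block diagonal with blocks $\Lambda_{[k]}$, up to the permutation between the ray-based and space-based orderings. $\Sigma_N=\Gamma_N\Psi_NW_N$, where $\Gamma_N=\mathrm{diag}(\gamma(x_i,r_k))$, $\Psi_N$ is block diagonal with blocks $[\Phi(x_i,r_k,r_l)]_{k,l}$, $i=1,\dots,N_s$, and $W_N=I\!d_{N_s}\otimes\frac1{N_r}\mathrm{diag}(w_k)$.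 Finally $A_N=I\!d_N-\Lambda_N\Sigma_N$. Consider a sequence of such discretizations with $N\to\infty$, such that, uniformly along the sequence: the weights are bounded; the interpolation matrices have row sums $1$, bounded infinity norm and a bounded number of nonzero entries per column; any two optical steps on the same characteristic have a bounded ratio; for every $\varepsilon>0$ there is $T$ such that at most $\varepsilon N_r$ rays have a characteristic of optical length greater than $T$; and $\max_kL_k=o(N)$ (automatic in the plane-parallel case). For matrices $B_N$ of size $N$, $\{B_N\}\sim_\sigma c$ (resp. $\sim_\lambda c$) means that $\frac1N\sum_iF(\sigma_i(B_N))\to F(|c|)$ (resp. $\frac1N\sum_iF(\lambda_i(B_N))\to F(c)$) for all continuous compactly supported $F$ on $[0,\infty)$ (resp. $\mathbb C$). A cluster at $s$ is weak (strong) if for every $\varepsilon>0$ the number of eigenvalues, or singular values, at distance at least $\varepsilon$ from $s$ is $o(N)$ ($O(1)$). **Theorem.** 1. Suppose that $\gamma$, possibly unbounded, is Riemann integrable on $D\times R$ in the general sense (Riemann integrable off Peano–Jordan subsets of arbitrarily small volume), and that the nodes $(x_i,r_k)$ do not concentrate: for every $\varepsilon>0$ there is $\delta>0$ such that every Peano–Jordan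 set $B\subset D\times R$ of volume less than $\delta$ contains at most $\varepsilon N$ of them for all large $N$. Then $\{A_N-I\!d_N\}\sim_\sigma0$, and the singular values of $\{A_N\}$ have a weak cluster at $1$. If moreover $\Sigma_N$ is bounded in spectral norm uniformly in $N$, then $\{A_N-I\!d_N\}\sim_\lambda0$, and the eigenvalues of $\{A_N\}$ have a weak cluster at $1$. 2. Suppose that $\gamma$ is bounded. Then $\{A_N-I\!d_N\}\sim_\sigma0$, $\{A_N-I\!d_N\}\sim_\lambda0$, and both the singular values and the eigenvalues of $\{A_N\}$ have a weak cluster at $1$. If moreover the numbers $L_k$ are bounded uniformly in $N$, as in the plane-parallel case, then both the eigenvalues and the singular values of $\{A_N\}$ have a strong cluster at $1$. -/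

import Mathlib

open Filter Topology MeasureTheory
open scoped NNReal ENNReal

/-! ### Eigenvalue and singular value distributions and clusters of matrix sequences -/

section Spectral

variable {ι : ℕ → Type*} [∀ n, Fintype (ι n)] [∀ n, DecidableEq (ι n)]

/-- The eigenvalues of a square complex matrix, counted with algebraic multiplicity. -/
noncomputable def matEigenvalues {α : Type*} [Fintype α] [DecidableEq α]
    (A : Matrix α α ℂ) : Multiset ℂ :=
  A.charpoly.roots

/-- The `i`-th singular value (`i = 0, …, card α - 1`, in decreasing order) of a square complex
matrix, as an operator on the Euclidean space `ℂ^α`. -/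
noncomputable def matSingularValue {α : Type*} [Fintype α] [DecidableEq α]
    (A : Matrix α α ℂ) (i : ℕ) : ℝ :=
  (Matrix.toEuclideanLin A).singularValues i

/-- `{A_n} ∼_λ (h, K)`: distribution in the eigenvalue sense as the function `h` on `K`. -/
def EigDistributed (A : ∀ n, Matrix (ι n) (ι n) ℂ) {p : ℕ} (h : (Fin p → ℝ) → ℂ)
    (K : Set (Fin p → ℝ)) : Prop :=
  ∀ F : ℂ → ℂ, Continuous F → HasCompactSupport F →
    Tendsto (fun n => (Fintype.card (ι n) : ℂ)⁻¹ * ((matEigenvalues (A n)).map F).sum) atTop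
      (𝓝 (((volume K).toReal : ℂ)⁻¹ * ∫ x in K, F (h x)))

/-- `{A_n} ∼_σ (h, K)`: distribution in the singular value sense as the function `h` on `K`.
The test functions live on the nonnegative reals. -/
def SingDistributed (A : ∀ n, Matrix (ι n) (ι n) ℂ) {p : ℕ} (h : (Fin p → ℝ) → ℂ)
    (K : Set (Fin p → ℝ)) : Prop :=
  ∀ F : ℝ≥0 → ℂ, Continuous F → HasCompactSupport F →
    Tendsto (fun n => (Fintype.card (ι n) : ℂ)⁻¹ *
        ∑ i ∈ Finset.range (Fintype.card (ι n)), F (matSingularValue (A n) i).toNNReal) atTop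
      (𝓝 (((volume K).toReal : ℂ)⁻¹ * ∫ x in K, F ‖h x‖₊))

/-- `{A_n} ∼_λ c` for a constant `c`: on every domain of positive and finite measure. -/
def EigDistributedConst (A : ∀ n, Matrix (ι n) (ι n) ℂ) (c : ℂ) : Prop :=
  ∀ (p : ℕ) (K : Set (Fin p → ℝ)), MeasurableSet K → 0 < volume K → volume K < ⊤ →
    EigDistributed A (fun _ => c) K

/-- `{A_n} ∼_σ c` for a constant `c`: on every domain of positive and finite measure. -/
def SingDistributedConst (A : ∀ n, Matrix (ι n) (ι n) ℂ) (c : ℂ) : Prop :=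
  ∀ (p : ℕ) (K : Set (Fin p → ℝ)), MeasurableSet K → 0 < volume K → volume K < ⊤ →
    SingDistributed A (fun _ => c) K

open Classical in
/-- The number of eigenvalues outside the open disk of radius `ε` around `s`. -/
noncomputable def eigOutliers {α : Type*} [Fintype α] [DecidableEq α]
    (A : Matrix α α ℂ) (s : ℂ) (ε : ℝ) : ℕ :=
  (matEigenvalues A).countP (fun z => ε ≤ ‖z - s‖)

open Classical in
/-- The number of singular values outside the open interval of radius `ε` around `s`. -/
noncomputable def singOutliers {α : Type*} [Fintype α] [DecidableEq α]
    (A : Matrix α α ℂ) (s : ℝ) (ε : ℝ) : ℕ :=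
  ((Finset.range (Fintype.card α)).filter (fun i => ε ≤ |matSingularValue A i - s|)).card

def WeakEigCluster (A : ∀ n, Matrix (ι n) (ι n) ℂ) (s : ℂ) : Prop :=
  ∀ ε : ℝ, 0 < ε →
    (fun n => (eigOutliers (A n) s ε : ℝ)) =o[atTop] (fun n => (Fintype.card (ι n) : ℝ))

def WeakSingCluster (A : ∀ n, Matrix (ι n) (ι n) ℂ) (s : ℝ) : Prop :=
  ∀ ε : ℝ, 0 < ε →
    (fun n => (singOutliers (A n) s ε : ℝ)) =o[atTop] (fun n => (Fintype.card (ι n) : ℝ))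

def StrongEigCluster (A : ∀ n, Matrix (ι n) (ι n) ℂ) (s : ℂ) : Prop :=
  ∀ ε : ℝ, 0 < ε → ∃ q : ℕ, ∀ n, eigOutliers (A n) s ε ≤ q

def StrongSingCluster (A : ∀ n, Matrix (ι n) (ι n) ℂ) (s : ℝ) : Prop :=
  ∀ ε : ℝ, 0 < ε → ∃ q : ℕ, ∀ n, singOutliers (A n) s ε ≤ q

end Spectral

/-! ### Peano–Jordan measurable sets and Riemann integrability -/

section Riemann

variable {κ : Type} [Fintype κ]

/-- Peano–Jordan measurable: bounded with a boundary of measure zero. -/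
def IsPeanoJordan (K : Set (κ → ℝ)) : Prop :=
  Bornology.IsBounded K ∧ volume (frontier K) = 0

/-- `f` is bounded on `K` and its extension by zero has a (proper) Riemann integral over a box
that contains `K`. -/
def IsRiemannIntegrableOn (f : (κ → ℝ) → ℝ) (K : Set (κ → ℝ)) : Prop :=
  (∃ C : ℝ, ∀ x ∈ K, |f x| ≤ C) ∧
  ∃ I : BoxIntegral.Box κ, K ⊆ BoxIntegral.Box.Icc I ∧
    BoxIntegral.Integrable I BoxIntegral.IntegrationParams.Riemann (K.indicator f)
      BoxIntegral.BoxAdditiveMap.volume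

/-- Riemann integrability in the general sense: `f` may be unbounded on `K`, but it is (properly)
Riemann integrable off Peano–Jordan measurable subsets of `K` of arbitrarily small volume. -/
def IsGenRiemannIntegrableOn (f : (κ → ℝ) → ℝ) (K : Set (κ → ℝ)) : Prop :=
  ∀ ε : ℝ, 0 < ε → ∃ B ⊆ K, IsPeanoJordan B ∧ volume B < ENNReal.ofReal ε ∧
    IsRiemannIntegrableOn f (K \ B)

end Riemann

/-! ### The radiative transfer problem -/

/-- The data of a linear radiative transfer problem in `d` space dimensions. A ray
`r = (direction, frequency)` is given by `m` real parameters, and `dir r` is the velocity with which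
space is traversed along `r`. Examples: `d = 1`, `m = 2`, `r = (μ, ν)`, `dir r = μ` for the
plane-parallel problem; `d = 3`, `r = (direction angles, ν)` with a unit vector `dir r`. -/
structure RTProblem (d m : ℕ) where
  /-- spatial domain -/
  D : Set (Fin d → ℝ)
  /-- set of the rays -/
  R : Set (Fin m → ℝ)
  /-- direction of a ray -/
  dir : (Fin m → ℝ) → (Fin d → ℝ)
  /-- extinction coefficient -/
  χ : (Fin d → ℝ) → (Fin m → ℝ) → ℝ
  /-- scattering coefficient -/
  σ : (Fin d → ℝ) → ℝ
  /-- scattering kernel -/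
  Φ : (Fin d → ℝ) → (Fin m → ℝ) → (Fin m → ℝ) → ℝ
  /-- surface measure of the set of directions; equal to `2` for the plane-parallel problem -/
  sd : ℝ
  D_peanoJordan : IsPeanoJordan D
  R_peanoJordan : IsPeanoJordan R
  dir_ne_zero : ∀ r ∈ R, dir r ≠ 0
  χ_pos : ∀ x ∈ D, ∀ r ∈ R, 0 < χ x r
  σ_nonneg : ∀ x ∈ D, 0 ≤ σ x
  sd_pos : 0 < sd

namespace RTProblem

variable {d m : ℕ} (Q : RTProblem d m)

/-- `γ = σ / (s_d χ)`, that is `σ / (2 χ)` for the plane-parallel problem. -/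
noncomputable def γ (x : Fin d → ℝ) (r : Fin m → ℝ) : ℝ := Q.σ x / (Q.sd * Q.χ x r)

/-- The phase space `D × R`, as a subset of `ℝ^(d + m)`. -/
def phaseSpace : Set (Fin d ⊕ Fin m → ℝ) := {p | p ∘ Sum.inl ∈ Q.D ∧ p ∘ Sum.inr ∈ Q.R}

def GammaBounded : Prop := ∃ C : ℝ, ∀ x ∈ Q.D, ∀ r ∈ Q.R, |Q.γ x r| ≤ C

def GammaGenRiemann : Prop :=
  IsGenRiemannIntegrableOn (fun p => Q.γ (p ∘ Sum.inl) (p ∘ Sum.inr)) Q.phaseSpace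

/-- `Φ(x, ·, ·)` is Riemann integrable on `R × R` for every `x`, with a bound that is uniform
in `x`. -/
def KernelRiemann : Prop :=
  (∀ x ∈ Q.D, IsRiemannIntegrableOn (fun p => Q.Φ x (p ∘ Sum.inl) (p ∘ Sum.inr))
    {p : Fin m ⊕ Fin m → ℝ | p ∘ Sum.inl ∈ Q.R ∧ p ∘ Sum.inr ∈ Q.R}) ∧
  ∃ C : ℝ, ∀ x ∈ Q.D, ∀ r ∈ Q.R, ∀ r' ∈ Q.R, |Q.Φ x r r'| ≤ C

end RTProblem

/-! ### Discretization -/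

/-- Implicit Euler transfer matrix on `M` nodes (numbered from `0`) that are traversed in increasing
order; `δ i` is the optical distance between the nodes `i` and `i + 1`. It gives the dependence of
the intensity on the source in `(1 + δ i) I (i + 1) = I i + δ i * S (i + 1)`. -/
noncomputable def transferDown (M : ℕ) (δ : ℕ → ℝ) : Matrix (Fin M) (Fin M) ℝ :=
  Matrix.of fun i j =>
    if 1 ≤ (j : ℕ) ∧ j ≤ i then
      δ (j - 1) / ∏ l ∈ Finset.Ico ((j : ℕ) - 1) i, (1 + δ l)
    else 0

/-- Implicit Euler transfer matrix on `M` nodes that are traversed in decreasing order: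
`(1 + δ i) I i = I (i + 1) + δ i * S i`. -/
noncomputable def transferUp (M : ℕ) (δ : ℕ → ℝ) : Matrix (Fin M) (Fin M) ℝ :=
  Matrix.of fun i j =>
    if i ≤ j ∧ (j : ℕ) + 1 < M then
      δ j / ∏ l ∈ Finset.Icc (i : ℕ) j, (1 + δ l)
    else 0

/-- A discrete ordinates / long characteristics discretization with `Ns` spatial nodes and `Nr` rays.
The `k`-th ray comes with `L k` parallel characteristics; the `ℓ`-th one carries the nodes
`base k ℓ + s k ℓ i • v`, `i < M k ℓ`, where `v` is the direction of the ray, reversed if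
`up k ℓ` (in which case radiation propagates towards decreasing `i`). `TCR k` and `TRC k` interpolate
from the spatial nodes to the nodes of the characteristics and back. In the plane-parallel case
`d = 1`, `L k = 1`, `M k ℓ = Ns`, `base k ℓ + s k ℓ i • v = x i`, `up k ℓ` iff `0 < μ`, and the two
interpolation operators are the identity. -/
structure RTGrid {d m : ℕ} (Q : RTProblem d m) where
  Ns : ℕ
  Nr : ℕ
  /-- spatial nodes -/
  x : Fin Ns → (Fin d → ℝ)
  /-- rays -/
  r : Fin Nr → (Fin m → ℝ)
  /-- quadrature weights; the quadrature rule is `(1 / Nr) ∑ k, w k * f (r k)` -/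
  w : Fin Nr → ℝ
  /-- number of characteristics of a ray -/
  L : Fin Nr → ℕ
  /-- number of nodes of a characteristic -/
  M : ∀ k, Fin (L k) → ℕ
  up : ∀ k, Fin (L k) → Bool
  base : ∀ k, Fin (L k) → (Fin d → ℝ)
  /-- node parameters along a characteristic; only the indices `i < M k ℓ` matter -/
  s : ∀ k, Fin (L k) → ℕ → ℝ
  TCR : ∀ k, Matrix (Σ ℓ : Fin (L k), Fin (M k ℓ)) (Fin Ns) ℝ
  TRC : ∀ k, Matrix (Fin Ns) (Σ ℓ : Fin (L k), Fin (M k ℓ)) ℝ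
  x_mem : ∀ i, x i ∈ Q.D
  r_mem : ∀ k, r k ∈ Q.R
  s_lt : ∀ k ℓ i, i + 1 < M k ℓ → s k ℓ i < s k ℓ (i + 1)
  segment_mem : ∀ k ℓ i, i + 1 < M k ℓ → ∀ t ∈ Set.Icc (s k ℓ i) (s k ℓ (i + 1)),
    base k ℓ + t • (if up k ℓ then -Q.dir (r k) else Q.dir (r k)) ∈ Q.D
  χ_integrable : ∀ k ℓ i, i + 1 < M k ℓ → IntervalIntegrable
    (fun t => Q.χ (base k ℓ + t • (if up k ℓ then -Q.dir (r k) else Q.dir (r k))) (r k))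
    volume (s k ℓ i) (s k ℓ (i + 1))

namespace RTGrid

variable {d m : ℕ} {Q : RTProblem d m} (G : RTGrid Q)

/-- Total number of degrees of freedom. -/
def N : ℕ := G.Ns * G.Nr

/-- Optical distance `Δτ` between consecutive nodes of a characteristic. -/
noncomputable def Δτ (k : Fin G.Nr) (ℓ : Fin (G.L k)) (i : ℕ) : ℝ :=
  ∫ t in (G.s k ℓ i)..(G.s k ℓ (i + 1)),
    Q.χ (G.base k ℓ + t • (if G.up k ℓ then -Q.dir (G.r k) else Q.dir (G.r k))) (G.r k)

/-- Optical length of a characteristic. -/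
noncomputable def opticalLength (k : Fin G.Nr) (ℓ : Fin (G.L k)) : ℝ :=
  ∑ i ∈ Finset.range (G.M k ℓ - 1), G.Δτ k ℓ i

/-- One-dimensional transfer matrix of a characteristic. -/
noncomputable def transferLine (k : Fin G.Nr) (ℓ : Fin (G.L k)) :
    Matrix (Fin (G.M k ℓ)) (Fin (G.M k ℓ)) ℝ :=
  if G.up k ℓ then transferUp (G.M k ℓ) (G.Δτ k ℓ) else transferDown (G.M k ℓ) (G.Δτ k ℓ)

/-- The block `Λ_[k]` of the `k`-th ray. -/
noncomputable def transferRay (k : Fin G.Nr) : Matrix (Fin G.Ns) (Fin G.Ns) ℝ :=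
  G.TRC k * Matrix.blockDiagonal' (G.transferLine k) * G.TCR k

/-- The transfer operator `Λ_N`. The vector of unknowns is indexed by pairs
`(spatial node, ray)`, which makes the passage between the space-based and the ray-based ordering
(the permutation `P`) implicit. -/
noncomputable def Lam : Matrix (Fin G.Ns × Fin G.Nr) (Fin G.Ns × Fin G.Nr) ℝ :=
  Matrix.blockDiagonal G.transferRay

/-- `Γ_N`, sampling `γ` at the nodes. -/
noncomputable def Gam : Matrix (Fin G.Ns × Fin G.Nr) (Fin G.Ns × Fin G.Nr) ℝ :=
  Matrix.diagonal fun a => Q.γ (G.x a.1) (G.r a.2)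

/-- The block `Ψ_[i]` of the `i`-th spatial node. -/
def PsiNode (i : Fin G.Ns) : Matrix (Fin G.Nr) (Fin G.Nr) ℝ :=
  Matrix.of fun k l => Q.Φ (G.x i) (G.r k) (G.r l)

/-- `Ψ_N`, block diagonal with respect to the spatial nodes. -/
def Psi : Matrix (Fin G.Ns × Fin G.Nr) (Fin G.Ns × Fin G.Nr) ℝ :=
  (Matrix.blockDiagonal G.PsiNode).submatrix Prod.swap Prod.swap

/-- `W_N`, the quadrature weights. -/
noncomputable def Wgt : Matrix (Fin G.Ns × Fin G.Nr) (Fin G.Ns × Fin G.Nr) ℝ :=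
  Matrix.diagonal fun a => G.w a.2 / G.Nr

/-- The scattering operator `Σ_N = Γ_N Ψ_N W_N`. -/
noncomputable def Sig : Matrix (Fin G.Ns × Fin G.Nr) (Fin G.Ns × Fin G.Nr) ℝ :=
  G.Gam * G.Psi * G.Wgt

/-- The global operator `A_N = Id - Λ_N Σ_N`, as a complex matrix. -/
noncomputable def A : Matrix (Fin G.Ns × Fin G.Nr) (Fin G.Ns × Fin G.Nr) ℂ :=
  (1 - G.Lam * G.Sig).map Complex.ofReal

/-- Spectral norm of the scattering operator. -/
noncomputable def scatteringNorm : ℝ := ‖Matrix.toEuclideanCLM (𝕜 := ℝ) G.Sig‖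

end RTGrid

/-- The properties of interpolation operators: rows that sum up to one, a bounded infinity norm, and
sparsity. -/
def IsInterpolation {α β : Type*} [Fintype α] [Fintype β] (q : ℕ) (T : Matrix α β ℝ) : Prop :=
  (∀ a, ∑ b, T a b = 1) ∧ (∀ a, ∑ b, |T a b| ≤ q) ∧ ∀ b, {a | T a b ≠ 0}.ncard ≤ q

section Refinement

variable {d m : ℕ} {Q : RTProblem d m} (G : ℕ → RTGrid Q)

def UniformInterpolation : Prop :=
  ∃ q : ℕ, ∀ n k, IsInterpolation q ((G n).TCR k) ∧ IsInterpolation q ((G n).TRC k)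

def BoundedWeights : Prop := ∃ C : ℝ, ∀ n k, |(G n).w k| ≤ C

/-- The optical steps on one and the same characteristic are comparable. -/
def QuasiUniformSteps : Prop :=
  ∃ C : ℝ, ∀ n k ℓ i j, i + 1 < (G n).M k ℓ → j + 1 < (G n).M k ℓ →
    (G n).Δτ k ℓ i ≤ C * (G n).Δτ k ℓ j

/-- All but an arbitrarily small fraction of the rays only have characteristics of bounded
optical length. -/
def TightOpticalLength : Prop :=
  ∀ ε : ℝ, 0 < ε → ∃ T : ℝ, ∀ n,
    ({k | ∃ ℓ, T < (G n).opticalLength k ℓ}.ncard : ℝ) ≤ ε * (G n).Nr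

/-- The number of characteristics of a ray is negligible with respect to `N`. -/
def FewCharacteristics : Prop :=
  ∀ ε : ℝ, 0 < ε → ∀ᶠ n in atTop, ∀ k, ((G n).L k : ℝ) ≤ ε * (G n).N

def BoundedCharacteristics : Prop := ∃ C : ℕ, ∀ n k, (G n).L k ≤ C

/-- Sets of small volume in the phase space asymptotically contain a small fraction of the nodes. -/
def NonconcentratingNodes : Prop :=
  ∀ ε : ℝ, 0 < ε → ∃ δ : ℝ, 0 < δ ∧ ∀ B ⊆ Q.phaseSpace, IsPeanoJordan B →
    volume B < ENNReal.ofReal δ →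
      ∀ᶠ n in atTop,
        ({a : Fin (G n).Ns × Fin (G n).Nr | Sum.elim ((G n).x a.1) ((G n).r a.2) ∈ B}.ncard : ℝ)
          ≤ ε * (G n).N

/-- The scattering operators are bounded in spectral norm. -/
def BoundedScattering : Prop := ∃ C : ℝ, ∀ n, (G n).scatteringNorm ≤ C

end Refinement

/-! ### Counting outlying eigenvalues and singular values of operators. -/

section SpectralCounting

open Module

variable {V : Type*} [NormedAddCommGroup V] [InnerProductSpace ℂ V]

/-! Everything rests on splitting the iteration matrix $\Lambda_N\Sigma_N$ as $R+E+Z$, with $R$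
small in Frobenius norm, $E$ small in spectral norm and $Z$ of low rank. An orthonormal family has
at most $\|R\|_F^2/\varepsilon^2$ members with $\|Ru\|\ge\varepsilon$. Applied to a Schur basis,
this counts the outlying eigenvalues (`countP_roots_charpoly_mul_sq_le`); applied to spans of right
singular vectors, cut down to $\ker Z$, it counts the outlying singular values
(`card_singularValues_outliers_mul_sq_le`). The eigenvalue count has to do without $Z$.

The splitting (`exists_decomposition`) comes from the structure of the two factors. If the optical
steps are comparable, the entries of an implicit Euler matrix decay geometrically away from the
diagonal. Its spectral norm is then bounded whatever the number and size of the steps, and its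
Frobenius norm is bounded by a multiple of the optical length (`transfer_bounds`). The factor
$\Sigma_N$ only couples rays at the same node, with entries $O(1/N_r)$ wherever $\gamma$ is bounded,
so that the squared Frobenius norm of the product is controlled by an average over the rays of those
of the $\Lambda_{[k]}$ (`frobSq_blockDiagonal_mul_le`).

Rays of bounded optical length thus make up $R$, with $\|R\|_F^2=O(\max_k L_k)$: this is $o(N)$ in
general, whence weak clusters, and $O(1)$ for bounded $L_k$, whence strong ones. The few rays with
long characteristics make up $E$ by the Schur test, as the column sums of $\Sigma_N$ over them are
small. The few rows at nodes where $\gamma$ may be large make up $Z$; if $\Sigma_N$ is bounded in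
spectral norm, these rows are also small in Frobenius norm relative to $N$, and $Z$ joins $R$. -/

theorem inner_eq_zero_of_mem_span_image {ι : Type*} [Fintype ι] (b : OrthonormalBasis ι ℂ V)
    (S : Set ι) {v : V} (hv : v ∈ Submodule.span ℂ (b '' S)) {i : ι} (hi : i ∉ S) :
    inner ℂ (b i) v = 0 := by
  induction hv using Submodule.span_induction with
  | mem x hx =>
    obtain ⟨j, hj, rfl⟩ := hx
    exact b.orthonormal.2 fun h => hi (h ▸ hj)
  | zero => simp
  | add x y _ _ hx hy => rw [inner_add_right, hx, hy, add_zero]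
  | smul c x _ hx => rw [inner_smul_right, hx, mul_zero]

theorem finrank_span_image_orthonormalBasis {ι : Type*} [Fintype ι] (b : OrthonormalBasis ι ℂ V)
    (S : Finset ι) : finrank ℂ (Submodule.span ℂ (b '' (S : Set ι))) = S.card := by
  have h := b.orthonormal.linearIndependent.comp (fun i : (S : Set ι) => (i : ι))
    Subtype.val_injective
  rw [Set.image_eq_range]
  have := finrank_span_eq_card h
  simpa [Function.comp_def] using this

variable [FiniteDimensional ℂ V]

/-- Schur triangulation, in terms of an orthonormal family. -/
theorem exists_orthonormal_triangular {n : ℕ} {V : Type*} [NormedAddCommGroup V]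
    [InnerProductSpace ℂ V] [FiniteDimensional ℂ V] (hn : finrank ℂ V = n) (T : V →ₗ[ℂ] V) :
    ∃ u : Fin n → V, Orthonormal ℂ u ∧ ∀ i j, i < j → inner ℂ (u i) (T (u j)) = 0 := by
  induction n generalizing V with
  | zero => exact ⟨Fin.elim0, ⟨fun i => i.elim0, fun i => i.elim0⟩, fun i => i.elim0⟩
  | succ n ih =>
    have : Nontrivial V := Module.nontrivial_of_finrank_pos (R := ℂ) (by omega)
    -- The eigenvector is one of the adjoint, so that its orthogonal complement is invariant under
    -- `T` and the induction continues there.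
    obtain ⟨μ, hμ⟩ := Module.End.exists_eigenvalue (LinearMap.adjoint T)
    obtain ⟨v, hv⟩ := hμ.exists_hasEigenvector
    have hv0 : ‖v‖ ≠ 0 := norm_ne_zero_iff.2 hv.2
    set W : Submodule ℂ V := (ℂ ∙ v)ᗮ with hW
    have hmem : ∀ w, w ∈ W ↔ inner ℂ v w = 0 := fun w =>
      Submodule.mem_orthogonal_singleton_iff_inner_right
    have hinv : ∀ w ∈ W, T w ∈ W := by
      intro w hw
      rw [hmem] at hw ⊢
      rw [← LinearMap.adjoint_inner_left, hv.apply_eq_smul, inner_smul_left, hw, mul_zero]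
    have hdim : finrank ℂ W = n := by
      have := Submodule.finrank_add_finrank_orthogonal (ℂ ∙ v)
      rw [finrank_span_singleton hv.2, hn] at this
      change finrank ℂ W = n
      rw [← hW] at this
      omega
    obtain ⟨u, hu, htri⟩ := ih hdim (T.restrict hinv)
    set e : V := ((‖v‖ : ℂ)⁻¹) • v with he
    have heW : ∀ w ∈ W, inner ℂ e w = 0 := by
      intro w hw
      rw [he, inner_smul_left, (hmem w).1 hw, mul_zero]
    have hen : ‖e‖ = 1 := by
      rw [he, norm_smul, norm_inv, Complex.norm_real, norm_norm, inv_mul_cancel₀ hv0]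
    refine ⟨Fin.cons e (fun i => (u i : V)), ⟨?_, ?_⟩, ?_⟩
    · intro i
      refine Fin.cases ?_ (fun i => ?_) i
      · simpa using hen
      · simpa using hu.1 i
    · intro i j hij
      revert hij
      refine Fin.cases ?_ (fun i => ?_) i <;> refine Fin.cases ?_ (fun j => ?_) j
      · simp
      · intro _
        simpa using heW _ (u j).2
      · intro _
        simpa using inner_eq_zero_symm.1 (heW _ (u i).2)
      · intro hij
        have := hu.2 (i := i) (j := j) (fun h => hij (by rw [h]))
        simpa using this
    · intro i j
      refine Fin.cases ?_ (fun i => ?_) i <;> refine Fin.cases ?_ (fun j => ?_) j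
      · simp
      · intro _
        simpa using heW _ (hinv _ (u j).2)
      · simp
      · intro hij
        have := htri i j (by simpa using hij)
        simpa using this

/-- Schur triangulation: the eigenvalues are the diagonal entries in some orthonormal basis. -/
theorem exists_orthonormal_roots_charpoly (T : V →ₗ[ℂ] V) :
    ∃ u : Fin (finrank ℂ V) → V, Orthonormal ℂ u ∧
      T.charpoly.roots = Finset.univ.val.map fun i => inner ℂ (u i) (T (u i)) := by
  obtain ⟨u, hu, htri⟩ := exists_orthonormal_triangular rfl T
  refine ⟨u, hu, ?_⟩
  obtain ⟨b, hb⟩ := Orthonormal.exists_orthonormalBasis_extension_of_card_eq (𝕜 := ℂ)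
    (ι := Fin (finrank ℂ V)) (E := V) (by simp) (v := u) (s := Set.univ)
    (hu.comp _ Subtype.val_injective)
  have hb' : ∀ i, b i = u i := fun i => hb i (Set.mem_univ i)
  -- The matrix of `T` in the basis `b` is lower triangular, hence the transposition.
  rw [← LinearMap.charpoly_toMatrix T b.toBasis, ← Matrix.charpoly_transpose,
    Matrix.charpoly_of_isUpperTriangular]
  · have := Polynomial.roots_multiset_prod_X_sub_C
      (Finset.univ.val.map fun i => inner ℂ (u i) (T (u i)))
    rw [Multiset.map_map] at this
    rw [← this, Finset.prod]
    simp [LinearMap.toMatrix_apply, OrthonormalBasis.repr_apply_apply, hb']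
  · intro i j hij
    simpa [LinearMap.toMatrix_apply, OrthonormalBasis.repr_apply_apply, hb'] using htri j i hij

/-- Outlying eigenvalues of a perturbation of a multiple of the identity by an operator `R` with a
small Hilbert-Schmidt norm and an operator `E` with a small norm. -/
theorem countP_roots_charpoly_mul_sq_le {T R E : V →ₗ[ℂ] V} {s : ℂ} {ε K : ℝ} (hε : 0 ≤ ε)
    (hT : ∀ v, T v = s • v + R v + E v) (hE : ∀ v, ‖E v‖ ≤ ε * ‖v‖)
    (hR : ∀ (k : ℕ) (u : Fin k → V), Orthonormal ℂ u → ∑ i, ‖R (u i)‖ ^ 2 ≤ K)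
    (p : ℂ → Prop) [DecidablePred p] (hp : ∀ z, p z → 2 * ε ≤ ‖z - s‖) :
    (T.charpoly.roots.countP p : ℝ) * ε ^ 2 ≤ K := by
  obtain ⟨u, hu, hroots⟩ := exists_orthonormal_roots_charpoly T
  rw [hroots, Multiset.countP_map]
  change ((Finset.univ.filter fun i => p (inner ℂ (u i) (T (u i)))).card : ℝ) * ε ^ 2 ≤ K
  refine le_trans ?_ (hR _ u hu)
  refine le_trans ?_ (Finset.sum_le_sum_of_subset_of_nonneg (Finset.filter_subset
    (fun i => p (inner ℂ (u i) (T (u i)))) _) fun i _ _ => by positivity)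
  rw [← nsmul_eq_mul]
  -- For an outlier, `‖R (u i)‖` is at least `2 * ε - ε`, so it adds at least `ε ^ 2` to the sum.
  refine Finset.card_nsmul_le_sum _ _ _ fun i hi => ?_
  have h1 := hp _ (Finset.mem_filter.1 hi).2
  have hself : inner ℂ (u i) (u i) = (1 : ℂ) := by
    rw [inner_self_eq_norm_sq_to_K, hu.1 i]; simp
  rw [hT, inner_add_right, inner_add_right, inner_smul_right, hself, mul_one] at h1
  have h2 : s + inner ℂ (u i) (R (u i)) + inner ℂ (u i) (E (u i)) - s =
    inner ℂ (u i) (R (u i)) + inner ℂ (u i) (E (u i)) := by ring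
  rw [h2] at h1
  have h3 := norm_add_le (inner ℂ (u i) (R (u i))) (inner ℂ (u i) (E (u i)))
  have h4 := norm_inner_le_norm (𝕜 := ℂ) (u i) (R (u i))
  have h5 := norm_inner_le_norm (𝕜 := ℂ) (u i) (E (u i))
  have h6 := hE (u i)
  rw [hu.1 i] at h4 h5 h6
  have : ε ≤ ‖R (u i)‖ := by linarith
  gcongr

/-- A subspace on which `R` is bounded below, up to an operator of low rank, has a dimension that is
controlled by the Hilbert-Schmidt norm of `R`. -/
theorem finrank_mul_sq_le {R Z : V →ₗ[ℂ] V} {ε K : ℝ} (hε : 0 ≤ ε)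
    (hR : ∀ (k : ℕ) (u : Fin k → V), Orthonormal ℂ u → ∑ i, ‖R (u i)‖ ^ 2 ≤ K)
    (X : Submodule ℂ V) (hX : ∀ v ∈ X, Z v = 0 → ε * ‖v‖ ≤ ‖R v‖) :
    (finrank ℂ X : ℝ) * ε ^ 2 ≤ K + finrank ℂ (LinearMap.range Z) * ε ^ 2 := by
  -- Passing to the kernel of `Z` costs at most rank `Z` dimensions, and an orthonormal basis of `Y`
  -- can be tested against `hR`.
  set Y := X ⊓ LinearMap.ker Z with hY
  have hdim : finrank ℂ X ≤ finrank ℂ Y + finrank ℂ (LinearMap.range Z) := by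
    have h1 := Submodule.finrank_sup_add_finrank_inf_eq X (LinearMap.ker Z)
    have h2 := LinearMap.finrank_range_add_finrank_ker Z
    have h3 := Submodule.finrank_le (X ⊔ LinearMap.ker Z)
    rw [← hY] at h1
    omega
  have hb := (stdOrthonormalBasis ℂ Y).orthonormal
  have hu : Orthonormal ℂ fun i => ((stdOrthonormalBasis ℂ Y i : Y) : V) :=
    hb.comp_linearIsometry Y.subtypeₗᵢ
  have h4 : (finrank ℂ Y : ℝ) * ε ^ 2 ≤ K := by
    refine le_trans ?_ (hR _ _ hu)
    have := Finset.card_nsmul_le_sum Finset.univ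
      (fun i => ‖R ((stdOrthonormalBasis ℂ Y i : Y) : V)‖ ^ 2) (ε ^ 2) fun i _ => by
        have hm := Submodule.mem_inf.1 (stdOrthonormalBasis ℂ Y i).2
        have := hX _ hm.1 (LinearMap.mem_ker.1 hm.2)
        rw [hu.1 i, mul_one] at this
        gcongr
    simpa using this
  have h5 : (finrank ℂ X : ℝ) ≤ finrank ℂ Y + finrank ℂ (LinearMap.range Z) := by
    exact_mod_cast hdim
  nlinarith [sq_nonneg ε]

/-- The norm of `T v` in terms of the right singular vectors. -/
theorem norm_apply_sq_eq_sum_singularValues (T : V →ₗ[ℂ] V) (v : V) :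
    ‖T v‖ ^ 2 = ∑ i : Fin (finrank ℂ V), T.singularValues i ^ 2 *
      ‖inner ℂ (T.isSymmetric_adjoint_comp_self.eigenvectorBasis rfl i) v‖ ^ 2 := by
  set hS := T.isSymmetric_adjoint_comp_self
  set b := hS.eigenvectorBasis rfl
  have h1 : ((‖T v‖ ^ 2 : ℝ) : ℂ) = inner ℂ v ((LinearMap.adjoint T ∘ₗ T) v) := by
    rw [LinearMap.comp_apply, LinearMap.adjoint_inner_right, inner_self_eq_norm_sq_to_K]
    simp
  apply Complex.ofReal_injective
  rw [h1, ← b.sum_inner_mul_inner, Complex.ofReal_sum]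
  refine Finset.sum_congr rfl fun i _ => ?_
  have h2 := hS.eigenvectorBasis_apply_self_apply rfl v i
  rw [OrthonormalBasis.repr_apply_apply, OrthonormalBasis.repr_apply_apply] at h2
  rw [h2, T.sq_singularValues_fin rfl i, ← inner_conj_symm v, mul_left_comm, Complex.conj_mul']
  simp

/-- In the right singular basis the squared norm of the image is a sum of squared coordinates with
weights $\sigma_i^2$, and vectors of the span have no coordinates outside `S`. -/
theorem mul_norm_le_norm_apply_of_mem_span (T : V →ₗ[ℂ] V) (S : Set (Fin (finrank ℂ V))) {c : ℝ}
    (hc : 0 ≤ c) (hS : ∀ i ∈ S, c ≤ T.singularValues i) {v : V}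
    (hv : v ∈ Submodule.span ℂ (T.isSymmetric_adjoint_comp_self.eigenvectorBasis rfl '' S)) :
    c * ‖v‖ ≤ ‖T v‖ := by
  refine le_of_sq_le_sq (α := ℝ) ?_ (norm_nonneg _)
  rw [mul_pow, norm_apply_sq_eq_sum_singularValues,
    ← (T.isSymmetric_adjoint_comp_self.eigenvectorBasis rfl).sum_sq_norm_inner_right v,
    Finset.mul_sum]
  refine Finset.sum_le_sum fun i _ => ?_
  by_cases hi : i ∈ S
  · have := hS i hi
    gcongr
  · rw [inner_eq_zero_of_mem_span_image _ S hv hi]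
    simp

theorem norm_apply_le_mul_norm_of_mem_span (T : V →ₗ[ℂ] V) (S : Set (Fin (finrank ℂ V))) {c : ℝ}
    (hc : 0 ≤ c) (hS : ∀ i ∈ S, T.singularValues i ≤ c) {v : V}
    (hv : v ∈ Submodule.span ℂ (T.isSymmetric_adjoint_comp_self.eigenvectorBasis rfl '' S)) :
    ‖T v‖ ≤ c * ‖v‖ := by
  refine le_of_sq_le_sq (α := ℝ) ?_ (by positivity)
  rw [mul_pow, norm_apply_sq_eq_sum_singularValues,
    ← (T.isSymmetric_adjoint_comp_self.eigenvectorBasis rfl).sum_sq_norm_inner_right v,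
    Finset.mul_sum]
  refine Finset.sum_le_sum fun i _ => ?_
  by_cases hi : i ∈ S
  · have := hS i hi
    have := T.singularValues_nonneg i
    gcongr
  · rw [inner_eq_zero_of_mem_span_image _ S hv hi]
    simp

/-- Outlying singular values of a perturbation of a multiple of an isometry by an operator `R` with a
small Hilbert-Schmidt norm, an operator `E` with a small norm and an operator `Z` of low rank. -/
theorem card_singularValues_outliers_mul_sq_le {T R E Z : V →ₗ[ℂ] V} {J : V →ₗ[ℂ] V} {s ε K : ℝ}
    (hs : 0 ≤ s) (hε : 0 < ε) (hJ : ∀ v, ‖J v‖ = s * ‖v‖)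
    (hT : ∀ v, T v = J v + R v + E v + Z v) (hE : ∀ v, ‖E v‖ ≤ ε * ‖v‖)
    (hR : ∀ (k : ℕ) (u : Fin k → V), Orthonormal ℂ u → ∑ i, ‖R (u i)‖ ^ 2 ≤ K) :
    (((Finset.range (finrank ℂ V)).filter fun i => 2 * ε ≤ |T.singularValues i - s|).card : ℝ) *
      ε ^ 2 ≤ 2 * (K + finrank ℂ (LinearMap.range Z) * ε ^ 2) := by
  classical
  set b := T.isSymmetric_adjoint_comp_self.eigenvectorBasis rfl with hb
  set S₁ := Finset.univ.filter fun i : Fin (finrank ℂ V) => s + 2 * ε ≤ T.singularValues i with hS₁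
  set S₂ := Finset.univ.filter fun i : Fin (finrank ℂ V) => T.singularValues i ≤ s - 2 * ε with hS₂
  have hcard : ((Finset.range (finrank ℂ V)).filter
      fun i => 2 * ε ≤ |T.singularValues i - s|).card ≤ S₁.card + S₂.card := by
    refine le_trans ?_ (Finset.card_union_le _ _)
    rw [← Finset.card_map Fin.valEmbedding (s := S₁ ∪ S₂)]
    refine Finset.card_le_card fun i hi => ?_
    obtain ⟨hi1, hi2⟩ := Finset.mem_filter.1 hi
    refine Finset.mem_map.2 ⟨⟨i, Finset.mem_range.1 hi1⟩, ?_, rfl⟩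
    rw [Finset.mem_union, hS₁, hS₂, Finset.mem_filter, Finset.mem_filter]
    rcases le_abs.1 hi2 with h | h
    · exact Or.inl ⟨Finset.mem_univ _, by change s + 2 * ε ≤ T.singularValues i; linarith⟩
    · exact Or.inr ⟨Finset.mem_univ _, by change T.singularValues i ≤ s - 2 * ε; linarith⟩
  have h₁ : (S₁.card : ℝ) * ε ^ 2 ≤ K + finrank ℂ (LinearMap.range Z) * ε ^ 2 := by
    rw [← finrank_span_image_orthonormalBasis b S₁]
    refine finrank_mul_sq_le hε.le hR _ fun v hv hZ => ?_
    have h := mul_norm_le_norm_apply_of_mem_span T S₁ (c := s + 2 * ε) (by positivity)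
      (fun i hi => (Finset.mem_filter.1 hi).2) hv
    rw [hT, hZ, add_zero] at h
    have h1 := norm_add_le (J v + R v) (E v)
    have h2 := norm_add_le (J v) (R v)
    have := hE v
    rw [hJ] at h2
    linarith
  have h₂ : (S₂.card : ℝ) * ε ^ 2 ≤ K + finrank ℂ (LinearMap.range Z) * ε ^ 2 := by
    rw [← finrank_span_image_orthonormalBasis b S₂]
    refine finrank_mul_sq_le hε.le hR _ fun v hv hZ => ?_
    -- Singular values are nonnegative: if `s < 2 * ε`, there are no outliers below `s`.
    rcases le_or_gt 0 (s - 2 * ε) with hpos | hneg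
    · have h := norm_apply_le_mul_norm_of_mem_span T S₂ hpos
        (fun i hi => (Finset.mem_filter.1 hi).2) hv
      have h0 : J v = T v - R v - E v := by rw [hT, hZ]; abel
      have h1 := norm_sub_le (T v - R v) (E v)
      have h2 := norm_sub_le (T v) (R v)
      rw [← h0, hJ] at h1
      have := hE v
      linarith
    · have hempty : S₂ = ∅ := Finset.filter_eq_empty_iff.2 fun i _ h => by
        have := T.singularValues_nonneg i
        linarith
      rw [hempty] at hv
      simp only [Finset.coe_empty, Set.image_empty, Submodule.span_empty, Submodule.mem_bot] at hv
      simp [hv]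
  have : (((Finset.range (finrank ℂ V)).filter
      fun i => 2 * ε ≤ |T.singularValues i - s|).card : ℝ) ≤ S₁.card + S₂.card := by
    exact_mod_cast hcard
  nlinarith [sq_nonneg ε]

end SpectralCounting

/-! ### Frobenius and spectral norm bounds for real matrices. -/

section MatrixBounds

open Matrix

variable {α β γ : Type*}

open Classical in
/-- The matrix `A` with all the rows outside `S` replaced by zero. -/
noncomputable def restrictRows (S : Set α) (A : Matrix α β ℝ) : Matrix α β ℝ :=
  Matrix.of fun i j => if i ∈ S then A i j else 0

theorem restrictRows_of_mem {S : Set α} (A : Matrix α β ℝ) {i : α} (hi : i ∈ S) (j : β) :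
    restrictRows S A i j = A i j := by simp [restrictRows, hi]

theorem restrictRows_of_notMem {S : Set α} (A : Matrix α β ℝ) {i : α} (hi : i ∉ S) (j : β) :
    restrictRows S A i j = 0 := by simp [restrictRows, hi]

variable [Fintype α] [Fintype β] [Fintype γ]

/-- The square of the Frobenius norm. -/
def frobSq (A : Matrix α β ℝ) : ℝ := ∑ i, ∑ j, A i j ^ 2

/-- `c` bounds the square of the spectral norm of `A`. -/
def SqOpBound (A : Matrix α β ℝ) (c : ℝ) : Prop :=
  ∀ v : β → ℝ, ∑ i, (A *ᵥ v) i ^ 2 ≤ c * ∑ j, v j ^ 2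

theorem frobSq_transpose (A : Matrix α β ℝ) : frobSq Aᵀ = frobSq A := Finset.sum_comm

theorem frobSq_neg (A : Matrix α β ℝ) : frobSq (-A) = frobSq A := by simp [frobSq]

theorem SqOpBound.neg {A : Matrix α β ℝ} {c : ℝ} (h : SqOpBound A c) : SqOpBound (-A) c := by
  intro v
  simpa [Matrix.neg_mulVec] using h v

theorem SqOpBound.mono {A : Matrix α β ℝ} {c c' : ℝ} (h : SqOpBound A c) (hc : c ≤ c') :
    SqOpBound A c' := fun v =>
  (h v).trans (mul_le_mul_of_nonneg_right hc (Finset.sum_nonneg fun _ _ => sq_nonneg _))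

theorem SqOpBound.mul {A : Matrix α β ℝ} {B : Matrix β γ ℝ} {a b : ℝ} (hA : SqOpBound A a)
    (hB : SqOpBound B b) (ha : 0 ≤ a) : SqOpBound (A * B) (a * b) := by
  intro v
  rw [← Matrix.mulVec_mulVec, mul_assoc]
  exact (hA _).trans (mul_le_mul_of_nonneg_left (hB v) ha)

/-- Schur test. -/
theorem sqOpBound_of_sum_abs_le {A : Matrix α β ℝ} {a b : ℝ} (ha : 0 ≤ a)
    (hrow : ∀ i, ∑ j, |A i j| ≤ a) (hcol : ∀ j, ∑ i, |A i j| ≤ b) : SqOpBound A (a * b) := by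
  intro v
  have h1 : ∀ i, (A *ᵥ v) i ^ 2 ≤ a * ∑ j, |A i j| * v j ^ 2 := by
    intro i
    have h2 : (A *ᵥ v) i ^ 2 ≤ (∑ j, |A i j|) * ∑ j, |A i j| * v j ^ 2 := by
      refine Finset.sum_sq_le_sum_mul_sum_of_sq_le_mul _ (fun j _ => abs_nonneg _)
        (fun j _ => by positivity) fun j _ => le_of_eq ?_
      rw [mul_pow, ← sq_abs (A i j)]
      ring
    exact h2.trans (mul_le_mul_of_nonneg_right (hrow i) (Finset.sum_nonneg fun _ _ => by positivity))
  calc ∑ i, (A *ᵥ v) i ^ 2 ≤ ∑ i, a * ∑ j, |A i j| * v j ^ 2 := Finset.sum_le_sum fun i _ => h1 i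
    _ = a * ∑ j, (∑ i, |A i j|) * v j ^ 2 := by
        rw [← Finset.mul_sum, Finset.sum_comm]
        simp_rw [Finset.sum_mul]
    _ ≤ a * ∑ j, b * v j ^ 2 := by
        gcongr with j _
        exact hcol j
    _ = a * b * ∑ j, v j ^ 2 := by rw [← Finset.mul_sum, mul_assoc]

/-- For $w=A^Tu$ one has $\|w\|^2=\langle u,Aw\rangle$; after Cauchy–Schwarz and squaring, a factor
$\|w\|^2$ cancels. -/
theorem SqOpBound.transpose {A : Matrix α β ℝ} {c : ℝ} (h : SqOpBound A c) (hc : 0 ≤ c) :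
    SqOpBound Aᵀ c := by
  intro u
  set w := Aᵀ *ᵥ u with hw
  set X := ∑ j, w j ^ 2 with hX
  have hX0 : 0 ≤ X := Finset.sum_nonneg fun _ _ => sq_nonneg _
  have h1 : X = ∑ i, u i * (A *ᵥ w) i := by
    have : w ⬝ᵥ w = u ⬝ᵥ (A *ᵥ w) := by
      rw [Matrix.dotProduct_mulVec u, ← Matrix.mulVec_transpose]
    simpa [dotProduct, hX, sq] using this
  have h2 : X ^ 2 ≤ (∑ i, u i ^ 2) * (c * X) := by
    calc X ^ 2 = (∑ i, u i * (A *ᵥ w) i) ^ 2 := by rw [← h1]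
      _ ≤ (∑ i, u i ^ 2) * ∑ i, (A *ᵥ w) i ^ 2 := Finset.sum_mul_sq_le_sq_mul_sq _ _ _
      _ ≤ _ := mul_le_mul_of_nonneg_left (h w) (Finset.sum_nonneg fun _ _ => sq_nonneg _)
  rcases hX0.eq_or_lt with h0 | h0
  · rw [← h0]
    exact mul_nonneg hc (Finset.sum_nonneg fun _ _ => sq_nonneg _)
  · refine le_of_mul_le_mul_right ?_ h0
    nlinarith

theorem frobSq_mul_le_mul_frobSq {A : Matrix α β ℝ} {c : ℝ} (h : SqOpBound A c)
    (B : Matrix β γ ℝ) : frobSq (A * B) ≤ c * frobSq B := by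
  rw [← frobSq_transpose, ← frobSq_transpose B, frobSq, frobSq, Finset.mul_sum]
  exact Finset.sum_le_sum fun j _ => h fun i => B i j

theorem frobSq_mul_le_frobSq_mul (A : Matrix α β ℝ) {B : Matrix β γ ℝ} {c : ℝ}
    (h : SqOpBound B c) (hc : 0 ≤ c) : frobSq (A * B) ≤ c * frobSq A := by
  rw [← frobSq_transpose, ← frobSq_transpose A, Matrix.transpose_mul]
  exact frobSq_mul_le_mul_frobSq (h.transpose hc) _

/-- A row of `A` is the image of a unit vector under the transpose. -/
theorem SqOpBound.sum_row_sq_le {A : Matrix α β ℝ} {c : ℝ} (h : SqOpBound A c) (hc : 0 ≤ c)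
    (i : α) : ∑ j, A i j ^ 2 ≤ c := by
  classical
  simpa [Matrix.mulVec_single_one, Pi.single_apply] using h.transpose hc (Pi.single i 1)

theorem sqOpBound_blockDiagonal [DecidableEq γ] {A : γ → Matrix α β ℝ} {c : ℝ}
    (h : ∀ k, SqOpBound (A k) c) : SqOpBound (Matrix.blockDiagonal A) c := by
  intro v
  have h1 : ∀ i k, (Matrix.blockDiagonal A *ᵥ v) (i, k) = (A k *ᵥ fun j => v (j, k)) i := by
    intro i k
    simp [Matrix.mulVec, dotProduct, Fintype.sum_prod_type, Matrix.blockDiagonal_apply, ite_mul]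
  rw [Fintype.sum_prod_type_right, Fintype.sum_prod_type_right, Finset.mul_sum]
  simp_rw [h1]
  exact Finset.sum_le_sum fun k _ => h k _

section Sigma

variable {m : γ → Type*} [∀ k, Fintype (m k)] [DecidableEq γ]

theorem sqOpBound_blockDiagonal' {A : ∀ k, Matrix (m k) (m k) ℝ} {c : ℝ}
    (h : ∀ k, SqOpBound (A k) c) : SqOpBound (Matrix.blockDiagonal' A) c := by
  intro v
  have h1 : ∀ k i, (Matrix.blockDiagonal' A *ᵥ v) ⟨k, i⟩ = (A k *ᵥ fun j => v ⟨k, j⟩) i := by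
    intro k i
    rw [Matrix.mulVec, dotProduct, Fintype.sum_sigma, Finset.sum_eq_single k]
    · simp [Matrix.mulVec, dotProduct]
    · intro l _ hl
      exact Finset.sum_eq_zero fun j _ => by
        rw [Matrix.blockDiagonal'_apply_ne _ _ _ hl.symm, zero_mul]
    · simp
  rw [Fintype.sum_sigma, Fintype.sum_sigma, Finset.mul_sum]
  simp_rw [h1]
  exact Finset.sum_le_sum fun k _ => h k _

theorem frobSq_blockDiagonal' (A : ∀ k, Matrix (m k) (m k) ℝ) :
    frobSq (Matrix.blockDiagonal' A) = ∑ k, frobSq (A k) := by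
  rw [frobSq, Fintype.sum_sigma]
  refine Finset.sum_congr rfl fun k _ => Finset.sum_congr rfl fun i _ => ?_
  rw [Fintype.sum_sigma, Finset.sum_eq_single k]
  · simp
  · intro l _ hl
    exact Finset.sum_eq_zero fun j _ => by
      rw [Matrix.blockDiagonal'_apply_ne _ _ _ hl.symm]; simp
  · simp

end Sigma

theorem rank_map_restrictRows_le (S : Set α) (A : Matrix α β ℝ) :
    ((restrictRows S A).map Complex.ofReal).rank ≤ S.ncard := by
  classical
  have h : (restrictRows S A).map Complex.ofReal =
      Matrix.diagonal (fun i => if i ∈ S then (1 : ℂ) else 0) * A.map Complex.ofReal := by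
    ext i j
    by_cases hi : i ∈ S <;> simp [restrictRows, hi]
  rw [h]
  refine (Matrix.rank_mul_le_left _ _).trans ?_
  rw [Matrix.rank_diagonal, ← Nat.card_coe_set_eq, Nat.card_eq_fintype_card]
  exact (Fintype.card_congr (Equiv.subtypeEquivRight fun i => by simp)).le

theorem frobSq_restrictRows_le (S : Set α) {A : Matrix α β ℝ} {c : ℝ} (h : SqOpBound A c)
    (hc : 0 ≤ c) : frobSq (restrictRows S A) ≤ c * S.ncard := by
  classical
  calc frobSq (restrictRows S A) ≤ ∑ i, if i ∈ S then c else 0 := by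
        refine Finset.sum_le_sum fun i _ => ?_
        by_cases hi : i ∈ S
        · simpa [restrictRows, hi] using h.sum_row_sq_le hc i
        · simp [restrictRows, hi]
    _ = c * S.ncard := by
        rw [← Finset.sum_filter, Finset.sum_const, nsmul_eq_mul, mul_comm]
        congr 2
        rw [← Set.ncard_coe_finset]
        congr 1
        ext i
        simp

end MatrixBounds

/-! ### Passage from real matrices to complex operators. -/

section Complexification

open Matrix

variable {α : Type*} [Fintype α] [DecidableEq α]

/-- A real matrix acts separately on the real and imaginary parts of a vector, so no constant is
lost. -/
theorem norm_toEuclideanLin_map_ofReal_le {A : Matrix α α ℝ} {ε : ℝ} (hε : 0 ≤ ε)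
    (h : SqOpBound A (ε ^ 2)) (v : EuclideanSpace ℂ α) :
    ‖Matrix.toEuclideanLin (A.map Complex.ofReal) v‖ ≤ ε * ‖v‖ := by
  refine le_of_sq_le_sq (α := ℝ) ?_ (by positivity)
  rw [mul_pow, EuclideanSpace.norm_sq_eq, EuclideanSpace.norm_sq_eq]
  have h1 : ∀ i, ‖Matrix.toEuclideanLin (A.map Complex.ofReal) v i‖ ^ 2 =
      (A *ᵥ fun j => (v j).re) i ^ 2 + (A *ᵥ fun j => (v j).im) i ^ 2 := by
    intro i
    rw [← Complex.normSq_eq_norm_sq, Complex.normSq_apply]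
    simp [Matrix.toLpLin_apply, Matrix.mulVec, dotProduct, sq]
  have h2 : ∀ j, ‖v j‖ ^ 2 = (v j).re ^ 2 + (v j).im ^ 2 := by
    intro j
    rw [← Complex.normSq_eq_norm_sq, Complex.normSq_apply, sq, sq]
  simp_rw [h1, h2, Finset.sum_add_distrib, mul_add]
  exact add_le_add (h _) (h _)

/-- Each coordinate of the image is an inner product with a row of `A`; Bessel's inequality bounds
the sum over the family by the squared norm of that row. -/
theorem sum_norm_toEuclideanLin_map_ofReal_sq_le (A : Matrix α α ℝ) {k : ℕ}
    (u : Fin k → EuclideanSpace ℂ α) (hu : Orthonormal ℂ u) :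
    ∑ i, ‖Matrix.toEuclideanLin (A.map Complex.ofReal) (u i)‖ ^ 2 ≤ frobSq A := by
  simp_rw [EuclideanSpace.norm_sq_eq]
  rw [Finset.sum_comm]
  refine Finset.sum_le_sum fun a _ => ?_
  set x : EuclideanSpace ℂ α := WithLp.toLp 2 fun j => (A a j : ℂ) with hx
  have h1 : ∀ v : EuclideanSpace ℂ α,
      Matrix.toEuclideanLin (A.map Complex.ofReal) v a = inner ℂ x v := by
    intro v
    simp [Matrix.toLpLin_apply, Matrix.mulVec, dotProduct, hx, PiLp.inner_apply, mul_comm]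
  have h2 : ‖x‖ ^ 2 = ∑ j, A a j ^ 2 := by
    rw [EuclideanSpace.norm_sq_eq]
    simp [hx]
  rw [← h2]
  simp_rw [h1, norm_inner_symm x]
  exact hu.sum_inner_products_le x

theorem charpoly_toEuclideanLin (A : Matrix α α ℂ) :
    (Matrix.toEuclideanLin A).charpoly = A.charpoly := by
  rw [Matrix.toEuclideanLin, Matrix.toLpLin_eq_toLin, Matrix.charpoly_toLin]

theorem eigOutliers_mul_sq_le {A R E : Matrix α α ℝ} {s ε : ℝ} (hε : 0 ≤ ε)
    (hA : A = s • (1 : Matrix α α ℝ) + R + E) (hE : SqOpBound E (ε ^ 2)) :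
    (eigOutliers (A.map Complex.ofReal) s (2 * ε) : ℝ) * ε ^ 2 ≤ frobSq R := by
  classical
  rw [eigOutliers, matEigenvalues, ← charpoly_toEuclideanLin]
  refine countP_roots_charpoly_mul_sq_le (s := (s : ℂ)) hε (fun v => ?_)
    (norm_toEuclideanLin_map_ofReal_le hε hE)
    (fun k u hu => sum_norm_toEuclideanLin_map_ofReal_sq_le R u hu) _ fun z hz => hz
  have : A.map Complex.ofReal = (s : ℂ) • (1 : Matrix α α ℂ) + R.map Complex.ofReal +
      E.map Complex.ofReal := by
    ext i j
    simp [hA, Matrix.one_apply, apply_ite]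
  rw [this]
  simp [Matrix.toLpLin_apply, Matrix.smul_mulVec]

theorem singOutliers_mul_sq_le {A R E Z : Matrix α α ℝ} {s ε : ℝ} (hs : 0 ≤ s) (hε : 0 < ε)
    (hA : A = s • (1 : Matrix α α ℝ) + R + E + Z) (hE : SqOpBound E (ε ^ 2)) :
    (singOutliers (A.map Complex.ofReal) s (2 * ε) : ℝ) * ε ^ 2 ≤
      2 * (frobSq R + (Z.map Complex.ofReal).rank * ε ^ 2) := by
  classical
  have h := card_singularValues_outliers_mul_sq_le
    (T := Matrix.toEuclideanLin (A.map Complex.ofReal))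
    (R := Matrix.toEuclideanLin (R.map Complex.ofReal))
    (E := Matrix.toEuclideanLin (E.map Complex.ofReal))
    (Z := Matrix.toEuclideanLin (Z.map Complex.ofReal)) (J := (s : ℂ) • LinearMap.id) hs hε
    (fun v => by simp [norm_smul, abs_of_nonneg hs]) (fun v => ?_)
    (norm_toEuclideanLin_map_ofReal_le hε.le hE)
    (fun k u hu => sum_norm_toEuclideanLin_map_ofReal_sq_le R u hu)
  · have hr : Module.finrank ℂ (LinearMap.range (Matrix.toEuclideanLin (Z.map Complex.ofReal))) =
        (Z.map Complex.ofReal).rank := by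
      rw [Matrix.toEuclideanLin, Matrix.toLpLin_eq_toLin, ← Matrix.rank_eq_finrank_range_toLin]
    rw [finrank_euclideanSpace, hr] at h
    exact h
  · have : A.map Complex.ofReal = (s : ℂ) • (1 : Matrix α α ℂ) + R.map Complex.ofReal +
        E.map Complex.ofReal + Z.map Complex.ofReal := by
      ext i j
      simp [hA, Matrix.one_apply, apply_ite]
    rw [this]
    simp [Matrix.toLpLin_apply, Matrix.smul_mulVec]

end Complexification

/-! ### Implicit Euler transfer matrices and interpolation matrices. -/

section TransferMatrices

/-- These are distinct terms of the series $q+q^2+\dots$ with $q=(1+a)^{-1}$, whose sum is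
$q/(1-q)=1/a$. -/
theorem sum_pow_succ_le_inv {ι : Type*} {a : ℝ} (ha : 0 < a) (s : Finset ι) (f : ι → ℕ)
    (hf : Set.InjOn f s) : ∑ j ∈ s, ((1 + a)⁻¹) ^ (f j + 1) ≤ a⁻¹ := by
  classical
  have hq0 : 0 ≤ (1 + a)⁻¹ := by positivity
  have hq1 : (1 + a)⁻¹ < 1 := inv_lt_one_of_one_lt₀ (by linarith)
  rw [← Finset.sum_image (f := fun n : ℕ => ((1 + a)⁻¹) ^ (n + 1)) hf]
  have hs := (hasSum_geometric_of_lt_one hq0 hq1).mul_right (1 + a)⁻¹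
  simp_rw [← pow_succ] at hs
  refine (hs.summable.sum_le_tsum _ fun n _ => by positivity).trans (le_of_eq ?_)
  rw [hs.tsum_eq]
  have h1 : 1 + a ≠ 0 := by positivity
  rw [← mul_inv, sub_mul, inv_mul_cancel₀ h1, one_mul, add_sub_cancel_left]

/-- With truncated subtraction the exponent is $|i-j|+1$; either side of the diagonal contributes at
most one geometric series. -/
theorem sum_pow_dist_succ_le {M : ℕ} {a : ℝ} (ha : 0 < a) (i : Fin M) :
    ∑ j : Fin M, ((1 + a)⁻¹) ^ (((i : ℕ) - j) + ((j : ℕ) - i) + 1) ≤ 2 * a⁻¹ := by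
  rw [← Finset.sum_filter_add_sum_filter_not _ (fun j : Fin M => j ≤ i), two_mul]
  refine add_le_add (sum_pow_succ_le_inv ha _ (fun j : Fin M => ((i : ℕ) - j) + ((j : ℕ) - i)) ?_)
    (sum_pow_succ_le_inv ha _ (fun j : Fin M => ((i : ℕ) - j) + ((j : ℕ) - i)) ?_)
  all_goals
    intro j hj l hl h
    simp only [Finset.coe_filter, Finset.mem_univ, true_and, Set.mem_ofPred_eq, Fin.le_def] at hj hl
    simp only at h
    omega

theorem div_prod_one_add_le {a b x : ℝ} {δ : ℕ → ℝ} {s : Finset ℕ} (ha : 0 < a)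
    (hs : ∀ l ∈ s, a ≤ δ l) (hx0 : 0 ≤ x) (hx : x ≤ b) :
    |x / ∏ l ∈ s, (1 + δ l)| ≤ b * ((1 + a)⁻¹) ^ s.card := by
  have h1 : (1 + a) ^ s.card ≤ ∏ l ∈ s, (1 + δ l) := by
    rw [← Finset.prod_const]
    exact Finset.prod_le_prod (fun _ _ => by positivity) fun l hl => by linarith [hs l hl]
  have h2 : 0 < (1 + a) ^ s.card := by positivity
  have hb : 0 ≤ b := hx0.trans hx
  rw [abs_of_nonneg (div_nonneg hx0 (h2.le.trans h1)), inv_pow, ← div_eq_mul_inv]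
  gcongr

theorem abs_transferDown_le {M : ℕ} {δ : ℕ → ℝ} {a b : ℝ} (ha : 0 < a)
    (h : ∀ l, l + 1 < M → a ≤ δ l ∧ δ l ≤ b) (hb : 0 ≤ b) (i j : Fin M) :
    |transferDown M δ i j| ≤ b * ((1 + a)⁻¹) ^ (((i : ℕ) - j) + ((j : ℕ) - i) + 1) := by
  rw [transferDown, Matrix.of_apply]
  split_ifs with hij
  · have hij' : (j : ℕ) ≤ i := hij.2
    have hj := h ((j : ℕ) - 1) (by omega)
    have := div_prod_one_add_le (s := Finset.Ico ((j : ℕ) - 1) i) (δ := δ) ha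
      (fun l hl => (h l (by have := Finset.mem_Ico.1 hl; omega)).1) (ha.le.trans hj.1) hj.2
    -- Because `1 ≤ j`, the product has `i - j + 1` factors, one more than the distance to the
    -- diagonal.
    rwa [Nat.card_Ico, show (i : ℕ) - (j - 1) = ((i : ℕ) - j) + ((j : ℕ) - i) + 1 by omega] at this
  · rw [abs_zero]
    positivity

theorem abs_transferUp_le {M : ℕ} {δ : ℕ → ℝ} {a b : ℝ} (ha : 0 < a)
    (h : ∀ l, l + 1 < M → a ≤ δ l ∧ δ l ≤ b) (hb : 0 ≤ b) (i j : Fin M) :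
    |transferUp M δ i j| ≤ b * ((1 + a)⁻¹) ^ (((i : ℕ) - j) + ((j : ℕ) - i) + 1) := by
  rw [transferUp, Matrix.of_apply]
  split_ifs with hij
  · have hij' : (i : ℕ) ≤ j := hij.1
    have hj := h j hij.2
    have := div_prod_one_add_le (s := Finset.Icc (i : ℕ) j) (δ := δ) ha
      (fun l hl => (h l (by have := Finset.mem_Icc.1 hl; omega)).1) (ha.le.trans hj.1) hj.2
    rwa [Nat.card_Icc, show (j : ℕ) + 1 - i = ((i : ℕ) - j) + ((j : ℕ) - i) + 1 by omega] at this
  · rw [abs_zero]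
    positivity

/-- The majorant is symmetric in `i` and `j`, so the Schur test applies with the same bound for rows
and columns. Only the ratio `b / a` enters, not the size of the steps. -/
theorem sqOpBound_of_abs_le_pow_dist {M : ℕ} {t : Matrix (Fin M) (Fin M) ℝ} {a b : ℝ} (ha : 0 < a)
    (hb : 0 ≤ b)
    (h : ∀ i j, |t i j| ≤ b * ((1 + a)⁻¹) ^ (((i : ℕ) - j) + ((j : ℕ) - i) + 1)) :
    SqOpBound t ((2 * (b / a)) ^ 2) := by
  have h1 : ∀ i : Fin M, ∑ j : Fin M, b * ((1 + a)⁻¹) ^ (((i : ℕ) - j) + ((j : ℕ) - i) + 1) ≤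
      2 * (b / a) := by
    intro i
    rw [← Finset.mul_sum]
    refine (mul_le_mul_of_nonneg_left (sum_pow_dist_succ_le ha i) hb).trans (le_of_eq ?_)
    ring
  rw [sq]
  refine sqOpBound_of_sum_abs_le (by positivity)
    (fun i => (Finset.sum_le_sum fun j _ => h i j).trans (h1 i))
    (fun j => (Finset.sum_le_sum fun i _ => h i j).trans ?_)
  refine le_trans (le_of_eq (Finset.sum_congr rfl fun i _ => ?_)) (h1 j)
  rw [Nat.add_comm ((i : ℕ) - j)]

theorem frobSq_le_of_abs_le {M : ℕ} {t : Matrix (Fin M) (Fin M) ℝ} {b : ℝ}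
    (h : ∀ i j, |t i j| ≤ b) : frobSq t ≤ (M * b) ^ 2 := by
  calc frobSq t ≤ ∑ _i : Fin M, ∑ _j : Fin M, b ^ 2 := by
        refine Finset.sum_le_sum fun i _ => Finset.sum_le_sum fun j _ => ?_
        rw [← sq_abs]
        have := h i j
        gcongr
    _ = (M * b) ^ 2 := by
        simp
        ring

/-- Bounds for implicit Euler transfer matrices with comparable positive steps. -/
theorem transfer_bounds {M : ℕ} {δ : ℕ → ℝ} {C : ℝ} (hC : 1 ≤ C) (hpos : ∀ i, i + 1 < M → 0 < δ i)
    (hratio : ∀ i j, i + 1 < M → j + 1 < M → δ i ≤ C * δ j) {t : Matrix (Fin M) (Fin M) ℝ}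
    (ht : t = transferDown M δ ∨ t = transferUp M δ) :
    SqOpBound t (4 * C ^ 4) ∧ frobSq t ≤ 4 * C ^ 4 * (∑ i ∈ Finset.range (M - 1), δ i) ^ 2 := by
  -- With fewer than two nodes there is no step and the matrix vanishes; otherwise step `0` serves
  -- as a reference.
  rcases le_or_gt M 1 with hM | hM
  · have h0 : t = 0 := by
      ext i j
      have hi := i.2
      have hj := j.2
      rcases ht with rfl | rfl
      · rw [transferDown, Matrix.of_apply, if_neg, Matrix.zero_apply]
        omega
      · rw [transferUp, Matrix.of_apply, if_neg, Matrix.zero_apply]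
        omega
    subst h0
    refine ⟨fun v => ?_, ?_⟩
    · simp only [Matrix.zero_mulVec, Pi.zero_apply]
      have : 0 ≤ ∑ j, v j ^ 2 := Finset.sum_nonneg fun _ _ => sq_nonneg _
      simp
      positivity
    · simp [frobSq]
      positivity
  · have h0 := hpos 0 (by omega)
    have hC0 : 0 < C := by linarith
    -- All steps lie between `a` and `b`, and `b / a = C ^ 2` is invariant under refinement of the
    -- grid.
    set a := δ 0 / C with ha
    set b := C * δ 0 with hb
    have ha0 : 0 < a := by positivity
    have hb0 : 0 ≤ b := by positivity
    have hab : ∀ l, l + 1 < M → a ≤ δ l ∧ δ l ≤ b := fun l hl =>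
      ⟨by rw [ha, div_le_iff₀' hC0]; exact hratio 0 l (by omega) hl, hratio l 0 hl (by omega)⟩
    have h : ∀ i j, |t i j| ≤ b * ((1 + a)⁻¹) ^ (((i : ℕ) - j) + ((j : ℕ) - i) + 1) := by
      rcases ht with rfl | rfl
      · exact abs_transferDown_le ha0 hab hb0
      · exact abs_transferUp_le ha0 hab hb0
    refine ⟨?_, ?_⟩
    · convert sqOpBound_of_abs_le_pow_dist ha0 hb0 h using 1
      have : b / a = C ^ 2 := by
        rw [ha, hb]
        field_simp
      rw [this]
      ring
    · have hle : ∀ i j, |t i j| ≤ b := fun i j =>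
        (h i j).trans (mul_le_of_le_one_right hb0 (pow_le_one₀ (by positivity)
          (inv_le_one_of_one_le₀ (by linarith))))
      refine (frobSq_le_of_abs_le hle).trans ?_
      have hsum : ((M - 1 : ℕ) : ℝ) * δ 0 ≤ C * ∑ i ∈ Finset.range (M - 1), δ i := by
        rw [Finset.mul_sum]
        have := Finset.card_nsmul_le_sum (Finset.range (M - 1)) (fun i => C * δ i) (δ 0)
          fun i hi => hratio 0 i (by omega) (by have := Finset.mem_range.1 hi; omega)
        simpa using this
      -- As `M ≥ 2`, nodes can be traded for steps, whose lengths add up to the optical length.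
      have hM2 : (M : ℝ) ≤ 2 * ((M - 1 : ℕ) : ℝ) := by
        have : M ≤ 2 * (M - 1) := by omega
        exact_mod_cast this
      have : (M : ℝ) * b ≤ 2 * C ^ 2 * ∑ i ∈ Finset.range (M - 1), δ i := by
        calc (M : ℝ) * b ≤ 2 * ((M - 1 : ℕ) : ℝ) * b := by gcongr
          _ = 2 * C * (((M - 1 : ℕ) : ℝ) * δ 0) := by rw [hb]; ring
          _ ≤ 2 * C * (C * ∑ i ∈ Finset.range (M - 1), δ i) := by gcongr
          _ = _ := by ring
      calc ((M : ℝ) * b) ^ 2 ≤ (2 * C ^ 2 * ∑ i ∈ Finset.range (M - 1), δ i) ^ 2 := by gcongr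
        _ = _ := by ring

/-- Schur test: the row sums are at most `q`, and a column has at most `q` nonzero entries of
modulus at most `q`, hence a sum of at most `q ^ 2`. -/
theorem IsInterpolation.sqOpBound {α β : Type*} [Fintype α] [Fintype β] {q : ℕ}
    {T : Matrix α β ℝ} (h : IsInterpolation q T) : SqOpBound T ((q : ℝ) ^ 3) := by
  classical
  obtain ⟨-, hrow, hcol⟩ := h
  rw [show (q : ℝ) ^ 3 = q * (q * q) by ring]
  refine sqOpBound_of_sum_abs_le (by positivity) hrow fun b => ?_
  have h1 : ∀ a, |T a b| ≤ q := fun a =>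
    (Finset.single_le_sum (f := fun b => |T a b|) (fun _ _ => abs_nonneg _)
      (Finset.mem_univ b)).trans (hrow a)
  have h2 : (Finset.univ.filter fun a => T a b ≠ 0).card ≤ q := by
    have := hcol b
    rwa [← Set.ncard_coe_finset, Finset.coe_filter_univ]
  calc ∑ a, |T a b| = ∑ a ∈ Finset.univ.filter fun a => T a b ≠ 0, |T a b| := by
        rw [Finset.sum_filter]
        refine Finset.sum_congr rfl fun a _ => ?_
        by_cases ha : T a b = 0 <;> simp [ha]
    _ ≤ (Finset.univ.filter fun a => T a b ≠ 0).card • (q : ℝ) :=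
        Finset.sum_le_card_nsmul _ _ _ fun a _ => h1 a
    _ ≤ q * q := by
        rw [nsmul_eq_mul]
        gcongr

end TransferMatrices

/-! ### Bounds for the transfer and scattering operators of one grid. -/

namespace RTGrid

variable {d m : ℕ} {Q : RTProblem d m} (G : RTGrid Q)

theorem Δτ_pos (k : Fin G.Nr) (ℓ : Fin (G.L k)) (i : ℕ) (hi : i + 1 < G.M k ℓ) :
    0 < G.Δτ k ℓ i :=
  intervalIntegral.intervalIntegral_pos_of_pos_on (G.χ_integrable k ℓ i hi)
    (fun t ht => Q.χ_pos _ (G.segment_mem k ℓ i hi t (Set.Ioo_subset_Icc_self ht)) _ (G.r_mem k))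
    (G.s_lt k ℓ i hi)

theorem opticalLength_nonneg (k : Fin G.Nr) (ℓ : Fin (G.L k)) : 0 ≤ G.opticalLength k ℓ :=
  Finset.sum_nonneg fun i hi =>
    (G.Δτ_pos k ℓ i (by have := Finset.mem_range.1 hi; omega)).le

theorem transferLine_bounds {C : ℝ} (hC : 1 ≤ C) (k : Fin G.Nr) (ℓ : Fin (G.L k))
    (h : ∀ i j, i + 1 < G.M k ℓ → j + 1 < G.M k ℓ → G.Δτ k ℓ i ≤ C * G.Δτ k ℓ j) :
    SqOpBound (G.transferLine k ℓ) (4 * C ^ 4) ∧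
      frobSq (G.transferLine k ℓ) ≤ 4 * C ^ 4 * G.opticalLength k ℓ ^ 2 := by
  refine transfer_bounds hC (G.Δτ_pos k ℓ) h ?_
  rw [transferLine]
  split_ifs
  · exact Or.inr rfl
  · exact Or.inl rfl

theorem sqOpBound_transferRay {C : ℝ} {q : ℕ} (hC : 1 ≤ C) (k : Fin G.Nr)
    (h : ∀ ℓ i j, i + 1 < G.M k ℓ → j + 1 < G.M k ℓ → G.Δτ k ℓ i ≤ C * G.Δτ k ℓ j)
    (hCR : IsInterpolation q (G.TCR k)) (hRC : IsInterpolation q (G.TRC k)) :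
    SqOpBound (G.transferRay k) ((q : ℝ) ^ 3 * (4 * C ^ 4) * (q : ℝ) ^ 3) :=
  (hRC.sqOpBound.mul (sqOpBound_blockDiagonal' fun ℓ => (G.transferLine_bounds hC k ℓ (h ℓ)).1)
    (by positivity)).mul hCR.sqOpBound (by positivity)

/-- Every characteristic contributes $O(T^2)$, however many nodes it carries, whence the factor `G.L
k`; the interpolations only cost their spectral norms. -/
theorem frobSq_transferRay_le {C T : ℝ} {q : ℕ} (hC : 1 ≤ C) (k : Fin G.Nr)
    (h : ∀ ℓ i j, i + 1 < G.M k ℓ → j + 1 < G.M k ℓ → G.Δτ k ℓ i ≤ C * G.Δτ k ℓ j)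
    (hCR : IsInterpolation q (G.TCR k)) (hRC : IsInterpolation q (G.TRC k))
    (hlen : ∀ ℓ, G.opticalLength k ℓ ≤ T) :
    frobSq (G.transferRay k) ≤ (q : ℝ) ^ 6 * (4 * C ^ 4 * T ^ 2) * G.L k := by
  have h1 : frobSq (Matrix.blockDiagonal' (G.transferLine k)) ≤ G.L k * (4 * C ^ 4 * T ^ 2) := by
    rw [frobSq_blockDiagonal']
    have := Finset.sum_le_card_nsmul Finset.univ (fun ℓ => frobSq (G.transferLine k ℓ))
      (4 * C ^ 4 * T ^ 2) fun ℓ _ => by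
        have h2 := hlen ℓ
        have h3 := G.opticalLength_nonneg k ℓ
        refine (G.transferLine_bounds hC k ℓ (h ℓ)).2.trans ?_
        gcongr
    simpa using this
  calc frobSq (G.transferRay k)
      ≤ (q : ℝ) ^ 3 * frobSq (G.TRC k * Matrix.blockDiagonal' (G.transferLine k)) :=
        frobSq_mul_le_frobSq_mul _ hCR.sqOpBound (by positivity)
    _ ≤ (q : ℝ) ^ 3 * ((q : ℝ) ^ 3 * (G.L k * (4 * C ^ 4 * T ^ 2))) := by
        gcongr
        exact (frobSq_mul_le_mul_frobSq hRC.sqOpBound _).trans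
          (mul_le_mul_of_nonneg_left h1 (by positivity))
    _ = _ := by ring

theorem Sig_apply (a b : Fin G.Ns × Fin G.Nr) :
    G.Sig a b = if a.1 = b.1 then
      Q.γ (G.x a.1) (G.r a.2) * Q.Φ (G.x a.1) (G.r a.2) (G.r b.2) * (G.w b.2 / G.Nr) else 0 := by
  rw [Sig, Wgt, Matrix.mul_diagonal, Gam, Matrix.diagonal_mul, Psi, Matrix.submatrix_apply,
    Matrix.blockDiagonal_apply]
  simp [PsiNode]

theorem abs_Sig_le {cγ cΦ cw : ℝ} (hγ0 : 0 ≤ cγ) (hΦ0 : 0 ≤ cΦ)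
    (hΦ : ∀ x ∈ Q.D, ∀ r ∈ Q.R, ∀ r' ∈ Q.R, |Q.Φ x r r'| ≤ cΦ) (hw : ∀ k, |G.w k| ≤ cw)
    {a : Fin G.Ns × Fin G.Nr} (ha : |Q.γ (G.x a.1) (G.r a.2)| ≤ cγ) (b : Fin G.Ns × Fin G.Nr) :
    |G.Sig a b| ≤ if a.1 = b.1 then cγ * cΦ * cw / G.Nr else 0 := by
  rw [Sig_apply]
  split_ifs
  · rw [abs_mul, abs_mul, abs_div, mul_div_assoc, Nat.abs_cast]
    have h1 := hΦ _ (G.x_mem a.1) _ (G.r_mem a.2) _ (G.r_mem b.2)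
    have h2 := hw b.2
    gcongr
  · simp

end RTGrid

/-! ### Products of block matrices by rays with block matrices by nodes. -/

section PhaseSpaceMatrices

variable {n p : ℕ} {X : Matrix (Fin n × Fin p) (Fin n × Fin p) ℝ} {c : ℝ}

/-- A matrix that only couples different rays at the same node, with entries of size `c / p`, acting
on a small set of rays. -/
theorem sqOpBound_of_couples_rays (hc : 0 ≤ c)
    (hX : ∀ a b, |X a b| ≤ if a.1 = b.1 then c / p else 0)
    {S : Set (Fin p)} (hS : ∀ a b, a.2 ∉ S → X a b = 0) {η : ℝ}
    (hη0 : 0 ≤ η) (hη : (S.ncard : ℝ) ≤ η * p) :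
    SqOpBound X (c * (η * c)) := by
  classical
  refine sqOpBound_of_sum_abs_le hc (fun a => ?_) fun b => ?_
  · refine (Finset.sum_le_sum fun b _ => hX a b).trans ?_
    rw [Fintype.sum_prod_type_right]
    simp only [Finset.sum_ite_eq, Finset.mem_univ, if_true, Finset.sum_const, Finset.card_univ,
      Fintype.card_fin, nsmul_eq_mul]
    rcases eq_or_ne (p : ℝ) 0 with h | h
    · rw [h]; simpa using hc
    · rw [mul_div_cancel₀ _ h]
  -- A column has at most `S.ncard` nonzero entries of size `c / p`, so its sum is only `η * c`:
  -- this is the small factor.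
  · have h1 : ∀ a, |X a b| ≤ if a.1 = b.1 then (if a.2 ∈ S then c / p else 0) else 0 := by
      intro a
      by_cases ha : a.2 ∈ S
      · simpa [ha] using hX a b
      · simp [hS a b ha, ha]
    refine (Finset.sum_le_sum fun a _ => h1 a).trans ?_
    rw [Fintype.sum_prod_type_right]
    simp only [Finset.sum_ite_eq', Finset.mem_univ, if_true]
    rw [← Finset.sum_filter, Finset.sum_const, nsmul_eq_mul]
    have h2 : (Finset.univ.filter fun k => k ∈ S).card = S.ncard := by
      rw [← Set.ncard_coe_finset, Finset.coe_filter_univ, Set.ofPred_mem_eq]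
    rw [h2]
    calc (S.ncard : ℝ) * (c / p) ≤ η * p * (c / p) := by gcongr
      _ ≤ η * c := by
        rcases eq_or_ne (p : ℝ) 0 with h | h
        · rw [h, mul_zero, zero_mul]
          positivity
        · rw [mul_assoc, mul_div_cancel₀ _ h]

/-- As `X` only couples at a node, every entry of the product is a single term `A k i j * X (j, k)
(j, l)`. For each ray `k` in `S`, summing the squares over `i`, `j` and the `p` values of `l` gives
at most `p * (c / p) ^ 2 * F`; the at most `p` rays in `S` give `c ^ 2 * F`. -/
theorem frobSq_blockDiagonal_mul_le
    (hX : ∀ a b, |X a b| ≤ if a.1 = b.1 then c / p else 0)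
    {A : Fin p → Matrix (Fin n) (Fin n) ℝ} {S : Set (Fin p)} {F : ℝ} (hF : 0 ≤ F)
    (hS : ∀ k ∈ S, frobSq (A k) ≤ F) (hXS : ∀ a b, a.2 ∉ S → X a b = 0) :
    frobSq (Matrix.blockDiagonal A * X) ≤ c ^ 2 * F := by
  have h1 : ∀ i k b, (Matrix.blockDiagonal A * X) (i, k) b = A k i b.1 * X (b.1, k) b := by
    intro i k b
    rw [Matrix.mul_apply, Fintype.sum_prod_type, Finset.sum_eq_single b.1]
    · simp [Matrix.blockDiagonal_apply, ite_mul]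
    · intro j _ hj
      refine Finset.sum_eq_zero fun l _ => ?_
      have := hX (j, l) b
      rw [if_neg hj] at this
      rw [abs_nonpos_iff.1 this, mul_zero]
    · simp
  have h2 : ∀ k, ∑ i, ∑ b, (Matrix.blockDiagonal A * X) (i, k) b ^ 2 ≤ p * ((c / p) ^ 2 * F) := by
    intro k
    by_cases hk : k ∈ S
    · calc ∑ i, ∑ b, (Matrix.blockDiagonal A * X) (i, k) b ^ 2
          ≤ ∑ i, ∑ b : Fin n × Fin p, A k i b.1 ^ 2 * (c / p) ^ 2 := by
            refine Finset.sum_le_sum fun i _ => Finset.sum_le_sum fun b _ => ?_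
            rw [h1, mul_pow]
            have := hX (b.1, k) b
            rw [if_pos rfl] at this
            rw [← sq_abs (X _ _)]
            gcongr
        _ = p * ((c / p) ^ 2 * frobSq (A k)) := by
            simp_rw [Fintype.sum_prod_type, Finset.sum_const, Finset.card_univ, Fintype.card_fin,
              nsmul_eq_mul, frobSq, Finset.mul_sum]
            refine Finset.sum_congr rfl fun i _ => Finset.sum_congr rfl fun j _ => ?_
            ring
        _ ≤ _ := by
            have := hS k hk
            gcongr
    · have h0 : ∀ i b, (Matrix.blockDiagonal A * X) (i, k) b = 0 := fun i b => by
        rw [h1, hXS (b.1, k) b hk, mul_zero]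
      simp only [h0]
      simp
      positivity
  rw [frobSq, Fintype.sum_prod_type_right]
  refine (Finset.sum_le_sum fun k _ => h2 k).trans ?_
  simp only [Finset.sum_const, Finset.card_univ, Fintype.card_fin, nsmul_eq_mul]
  rcases eq_or_ne (p : ℝ) 0 with h | h
  · rw [h, zero_mul]
    positivity
  · refine le_of_eq ?_
    field_simp

end PhaseSpaceMatrices

/-! ### From matrix decompositions to clusters and distributions. -/

section Clusters

variable {ι : ℕ → Type*} [∀ n, Fintype (ι n)] [∀ n, DecidableEq (ι n)]

theorem card_matEigenvalues {α : Type*} [Fintype α] [DecidableEq α] (A : Matrix α α ℂ) :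
    Multiset.card (matEigenvalues A) = Fintype.card α := by
  rw [matEigenvalues, ← (IsAlgClosed.splits A.charpoly).natDegree_eq_card_roots,
    Matrix.charpoly_natDegree_eq_dim]

/-- A multiset sum over a function that is close to a constant outside of few exceptions. -/
theorem norm_inv_card_mul_sum_sub_le {s : Multiset ℂ} {c : ℂ} {η B : ℝ} (p : ℂ → Prop)
    [DecidablePred p] (hη : 0 ≤ η) (h1 : ∀ z ∈ s, p z → ‖z - c‖ ≤ B)
    (h2 : ∀ z ∈ s, ¬ p z → ‖z - c‖ ≤ η) :
    ‖s.sum - Multiset.card s * c‖ ≤ B * s.countP p + η * Multiset.card s := by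
  induction s using Multiset.induction_on with
  | empty => simp
  | cons a s ih =>
    have ih' := ih (fun z hz => h1 z (Multiset.mem_cons_of_mem hz))
      (fun z hz => h2 z (Multiset.mem_cons_of_mem hz))
    rw [Multiset.sum_cons, Multiset.card_cons, Multiset.countP_cons]
    have h3 : a + s.sum - ((Multiset.card s + 1 : ℕ) : ℂ) * c =
        (a - c) + (s.sum - Multiset.card s * c) := by
      push_cast
      ring
    rw [h3]
    refine (norm_add_le _ _).trans ?_
    by_cases hp : p a
    · have := h1 a (Multiset.mem_cons_self _ _) hp
      rw [if_pos hp]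
      push_cast
      linarith
    · have := h2 a (Multiset.mem_cons_self _ _) hp
      rw [if_neg hp]
      push_cast
      linarith

/-- Averages of a bounded function that is nearly constant outside of a negligible fraction. -/
theorem tendsto_average_of_few_exceptions {N : ℕ → ℕ} (hN : Tendsto N atTop atTop)
    {s : ℕ → Multiset ℂ} (hs : ∀ n, Multiset.card (s n) = N n) {c : ℂ} {B : ℝ}
    (hB : ∀ n, ∀ z ∈ s n, ‖z - c‖ ≤ B)
    (h : ∀ η : ℝ, 0 < η → ∃ k : ℕ → ℕ, (fun n => (k n : ℝ)) =o[atTop] (fun n => (N n : ℝ)) ∧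
      ∀ n, (s n).countP (fun z => η < ‖z - c‖) ≤ k n) :
    Tendsto (fun n => (N n : ℂ)⁻¹ * (s n).sum) atTop (𝓝 c) := by
  rw [Metric.tendsto_atTop']
  intro ε hε
  set B' := max B 1 with hB'
  have hB'0 : 0 < B' := lt_of_lt_of_le one_pos (le_max_right _ _)
  obtain ⟨k, hk, hcount⟩ := h (ε / 4) (by positivity)
  have h1 := hk.def (show 0 < ε / (4 * B') by positivity)
  obtain ⟨n₀, hn₀⟩ := eventually_atTop.1 (h1.and (hN.eventually_gt_atTop 0))
  refine ⟨n₀, fun n hn => ?_⟩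
  obtain ⟨h2, h3⟩ := hn₀ n hn.le
  have h3' : (0 : ℝ) < N n := by exact_mod_cast h3
  have h3c : (N n : ℂ) ≠ 0 := by exact_mod_cast h3.ne'
  have h4 := norm_inv_card_mul_sum_sub_le (s := s n) (c := c) (η := ε / 4) (B := B')
    (fun z => ε / 4 < ‖z - c‖) (by positivity)
    (fun z hz _ => (hB n z hz).trans (le_max_left _ _)) (fun z _ hz => not_lt.1 hz)
  rw [hs] at h4
  rw [dist_eq_norm]
  have h5 : (N n : ℂ)⁻¹ * (s n).sum - c = (N n : ℂ)⁻¹ * ((s n).sum - N n * c) := by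
    rw [mul_sub, inv_mul_cancel_left₀ h3c]
  rw [h5, norm_mul, norm_inv, Complex.norm_natCast, inv_mul_lt_iff₀ h3']
  have h6 : ((s n).countP (fun z => ε / 4 < ‖z - c‖) : ℝ) ≤ k n := by exact_mod_cast hcount n
  rw [Real.norm_of_nonneg (by positivity), Real.norm_of_nonneg (by positivity)] at h2
  have h7 : B' * ((s n).countP (fun z => ε / 4 < ‖z - c‖) : ℝ) ≤ ε / 4 * N n := by
    calc B' * ((s n).countP (fun z => ε / 4 < ‖z - c‖) : ℝ)
        ≤ B' * (ε / (4 * B') * N n) := by gcongr; exact h6.trans h2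
      _ = ε / 4 * N n := by field_simp
  nlinarith [mul_pos hε h3']

theorem inv_volume_mul_setIntegral_const {p : ℕ} {K : Set (Fin p → ℝ)} (h0 : 0 < volume K)
    (h1 : volume K < ⊤) (c : ℂ) : ((volume K).toReal : ℂ)⁻¹ * ∫ _x in K, c = c := by
  have : (volume K).toReal ≠ 0 := (ENNReal.toReal_pos h0.ne' h1.ne).ne'
  rw [setIntegral_const, Measure.real, Complex.real_smul, inv_mul_cancel_left₀]
  exact_mod_cast this

/-- By continuity `F` is nearly `F c` around `c`; the $o(N)$ eigenvalues farther away do not matter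
on average because `F` is bounded. -/
theorem WeakEigCluster.eigDistributedConst {A : ∀ n, Matrix (ι n) (ι n) ℂ} {c : ℂ}
    (h : WeakEigCluster A c) (hN : Tendsto (fun n => Fintype.card (ι n)) atTop atTop) :
    EigDistributedConst A c := by
  classical
  intro p K _ hK0 hK1 F hF hFc
  rw [inv_volume_mul_setIntegral_const hK0 hK1]
  obtain ⟨B, hB⟩ := hF.bounded_above_of_compact_support hFc
  refine tendsto_average_of_few_exceptions hN (B := 2 * B)
    (fun n => by rw [Multiset.card_map, card_matEigenvalues]) (fun n z hz => ?_) fun η hη => ?_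
  · obtain ⟨w, -, rfl⟩ := Multiset.mem_map.1 hz
    have := norm_sub_le (F w) (F c)
    linarith [hB w, hB c]
  · obtain ⟨δ, hδ, hclose⟩ := Metric.continuousAt_iff.1 (hF.continuousAt (x := c)) η hη
    refine ⟨fun n => eigOutliers (A n) c δ, h δ hδ, fun n => ?_⟩
    change _ ≤ eigOutliers (A n) c δ
    rw [Multiset.countP_map, eigOutliers, Multiset.countP_eq_card_filter]
    refine Multiset.card_le_card (Multiset.monotone_filter_right _ fun z hz => ?_)
    by_contra hlt
    have := hclose (x := z) (by rw [dist_eq_norm]; exact not_le.1 hlt)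
    rw [dist_eq_norm] at this
    exact absurd hz (not_lt.2 this.le)

theorem WeakSingCluster.singDistributedConst {A : ∀ n, Matrix (ι n) (ι n) ℂ}
    (h : WeakSingCluster A 0) (hN : Tendsto (fun n => Fintype.card (ι n)) atTop atTop) :
    SingDistributedConst A 0 := by
  classical
  intro p K _ hK0 hK1 F hF hFc
  rw [inv_volume_mul_setIntegral_const hK0 hK1, nnnorm_zero]
  obtain ⟨B, hB⟩ := hF.bounded_above_of_compact_support hFc
  refine tendsto_average_of_few_exceptions hN (B := 2 * B)
    (s := fun n => (Finset.range (Fintype.card (ι n))).val.map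
      fun i => F (matSingularValue (A n) i).toNNReal)
    (fun n => by simp) (fun n z hz => ?_) fun η hη => ?_
  · obtain ⟨w, -, rfl⟩ := Multiset.mem_map.1 hz
    refine (norm_sub_le _ _).trans ?_
    linarith [hB (matSingularValue (A n) w).toNNReal, hB 0]
  · obtain ⟨δ, hδ, hclose⟩ := Metric.continuousAt_iff.1 (hF.continuousAt (x := 0)) η hη
    refine ⟨fun n => singOutliers (A n) 0 δ, h δ hδ, fun n => ?_⟩
    change _ ≤ singOutliers (A n) 0 δ
    rw [Multiset.countP_map, singOutliers]
    refine Multiset.card_le_card (Multiset.monotone_filter_right _ fun i hi => ?_)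
    by_contra hlt
    have h0 : 0 ≤ matSingularValue (A n) i := LinearMap.singularValues_nonneg _ _
    have := hclose (x := (matSingularValue (A n) i).toNNReal) (by
      rw [NNReal.dist_eq, Real.coe_toNNReal _ h0]
      exact not_le.1 hlt)
    rw [dist_eq_norm] at this
    exact absurd hi (not_lt.2 this.le)

/-- A multiple of the identity plus a matrix of small Frobenius norm plus a matrix of small spectral
norm has a weak eigenvalue cluster. -/
theorem weakEigCluster_of_decomposition {A : ∀ n, Matrix (ι n) (ι n) ℝ} {s : ℝ}
    (h : ∀ ε : ℝ, 0 < ε → ∀ η : ℝ, 0 < η → ∀ᶠ n in atTop, ∃ R E,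
      A n = s • (1 : Matrix (ι n) (ι n) ℝ) + R + E ∧ SqOpBound E (ε ^ 2) ∧
      frobSq R ≤ η * Fintype.card (ι n)) :
    WeakEigCluster (fun n => (A n).map Complex.ofReal) s := by
  intro ε hε
  refine Asymptotics.IsLittleO.of_bound fun η hη => ?_
  filter_upwards [h (ε / 2) (by positivity) (η * (ε / 2) ^ 2) (by positivity)] with n hn
  obtain ⟨R, E, hA, hE, hR⟩ := hn
  have h1 := eigOutliers_mul_sq_le (by positivity) hA hE
  rw [mul_div_cancel₀ ε two_ne_zero] at h1
  rw [Real.norm_of_nonneg (by positivity), Real.norm_of_nonneg (by positivity)]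
  refine le_of_mul_le_mul_right (h1.trans (hR.trans (le_of_eq ?_))) (by positivity : 0 < (ε / 2) ^ 2)
  ring

theorem weakSingCluster_of_decomposition {A : ∀ n, Matrix (ι n) (ι n) ℝ} {s : ℝ} (hs : 0 ≤ s)
    (h : ∀ ε : ℝ, 0 < ε → ∀ η : ℝ, 0 < η → ∀ᶠ n in atTop, ∃ R E Z,
      A n = s • (1 : Matrix (ι n) (ι n) ℝ) + R + E + Z ∧ SqOpBound E (ε ^ 2) ∧
      frobSq R ≤ η * Fintype.card (ι n) ∧
      ((Z.map Complex.ofReal).rank : ℝ) ≤ η * Fintype.card (ι n)) :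
    WeakSingCluster (fun n => (A n).map Complex.ofReal) s := by
  intro ε hε
  refine Asymptotics.IsLittleO.of_bound fun η hη => ?_
  set e := ε / 2 with he
  have he0 : 0 < e := by positivity
  -- Chosen so that `2 * (c + c * e ^ 2) = η * e ^ 2`.
  set c := η * e ^ 2 / (2 * (1 + e ^ 2)) with hc
  filter_upwards [h e he0 c (by positivity)] with n hn
  obtain ⟨R, E, Z, hA, hE, hR, hZ⟩ := hn
  have h1 := singOutliers_mul_sq_le hs he0 hA hE
  rw [he, mul_div_cancel₀ ε two_ne_zero, ← he] at h1
  rw [Real.norm_of_nonneg (by positivity), Real.norm_of_nonneg (by positivity)]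
  refine le_of_mul_le_mul_right (h1.trans ?_) (by positivity : 0 < e ^ 2)
  calc 2 * (frobSq R + (Z.map Complex.ofReal).rank * e ^ 2)
      ≤ 2 * (c * Fintype.card (ι n) + c * Fintype.card (ι n) * e ^ 2) := by gcongr
    _ = η * Fintype.card (ι n) * e ^ 2 := by
        rw [hc]
        field_simp

/-- A Frobenius bound that is uniform in `n`, rather than $o(N)$, bounds the number of outliers by a
constant. -/
theorem strongEigCluster_of_decomposition {A : ∀ n, Matrix (ι n) (ι n) ℝ} {s : ℝ}
    (h : ∀ ε : ℝ, 0 < ε → ∃ K : ℝ, ∀ n, ∃ R E,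
      A n = s • (1 : Matrix (ι n) (ι n) ℝ) + R + E ∧ SqOpBound E (ε ^ 2) ∧ frobSq R ≤ K) :
    StrongEigCluster (fun n => (A n).map Complex.ofReal) s := by
  intro ε hε
  obtain ⟨K, hK⟩ := h (ε / 2) (by positivity)
  refine ⟨⌈K / (ε / 2) ^ 2⌉₊, fun n => ?_⟩
  obtain ⟨R, E, hA, hE, hR⟩ := hK n
  have h1 := eigOutliers_mul_sq_le (by positivity) hA hE
  rw [mul_div_cancel₀ ε two_ne_zero] at h1
  have h2 : (eigOutliers ((A n).map Complex.ofReal) s ε : ℝ) ≤ K / (ε / 2) ^ 2 := by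
    rw [le_div_iff₀ (by positivity)]
    exact h1.trans hR
  exact_mod_cast h2.trans (Nat.le_ceil _)

theorem strongSingCluster_of_decomposition {A : ∀ n, Matrix (ι n) (ι n) ℝ} {s : ℝ} (hs : 0 ≤ s)
    (h : ∀ ε : ℝ, 0 < ε → ∃ K : ℝ, ∀ n, ∃ R E,
      A n = s • (1 : Matrix (ι n) (ι n) ℝ) + R + E ∧ SqOpBound E (ε ^ 2) ∧ frobSq R ≤ K) :
    StrongSingCluster (fun n => (A n).map Complex.ofReal) s := by
  intro ε hε
  obtain ⟨K, hK⟩ := h (ε / 2) (by positivity)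
  refine ⟨⌈2 * K / (ε / 2) ^ 2⌉₊, fun n => ?_⟩
  obtain ⟨R, E, hA, hE, hR⟩ := hK n
  have h1 := singOutliers_mul_sq_le (A := A n) (R := R) (E := E) (Z := 0) (ε := ε / 2) hs (by positivity)
    (by rw [add_zero, hA]) hE
  rw [mul_div_cancel₀ ε two_ne_zero] at h1
  have h2 : (singOutliers ((A n).map Complex.ofReal) s ε : ℝ) ≤ 2 * K / (ε / 2) ^ 2 := by
    rw [le_div_iff₀ (by positivity)]
    have h3 : ((0 : Matrix (ι n) (ι n) ℝ).map Complex.ofReal).rank = 0 := by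
      rw [Matrix.map_zero _ Complex.ofReal_zero, Matrix.rank_zero]
    rw [h3, Nat.cast_zero, zero_mul, add_zero] at h1
    linarith
  exact_mod_cast h2.trans (Nat.le_ceil _)

end Clusters

/-! ### The splitting of the iteration matrix. -/

section Decomposition

variable {d m : ℕ} {Q : RTProblem d m} {G : ℕ → RTGrid Q}

theorem RTGrid.sqOpBound_Sig (G : RTGrid Q) {C : ℝ} (h : G.scatteringNorm ≤ C) :
    SqOpBound G.Sig (C ^ 2) := by
  intro v
  have h1 := (Matrix.toEuclideanCLM (𝕜 := ℝ) G.Sig).le_of_opNorm_le h (WithLp.toLp 2 v)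
  have h2 := pow_le_pow_left₀ (norm_nonneg _) h1 2
  rw [mul_pow, EuclideanSpace.norm_sq_eq, EuclideanSpace.norm_sq_eq] at h2
  simpa using h2

theorem exists_ratio_bound (hstep : QuasiUniformSteps G) : ∃ C : ℝ, 1 ≤ C ∧
    ∀ n k ℓ i j, i + 1 < (G n).M k ℓ → j + 1 < (G n).M k ℓ →
      (G n).Δτ k ℓ i ≤ C * (G n).Δτ k ℓ j := by
  obtain ⟨C, hC⟩ := hstep
  refine ⟨max C 1, le_max_right _ _, fun n k ℓ i j hi hj => (hC n k ℓ i j hi hj).trans ?_⟩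
  have := (G n).Δτ_pos k ℓ j hj
  gcongr
  exact le_max_left _ _

theorem exists_sqOpBound_Lam (hT : UniformInterpolation G) (hstep : QuasiUniformSteps G) :
    ∃ c : ℝ, 0 ≤ c ∧ ∀ n, SqOpBound (G n).Lam c := by
  obtain ⟨q, hq⟩ := hT
  obtain ⟨C, hC1, hC⟩ := exists_ratio_bound hstep
  exact ⟨(q : ℝ) ^ 3 * (4 * C ^ 4) * (q : ℝ) ^ 3, by positivity, fun n =>
    sqOpBound_blockDiagonal fun k =>
      (G n).sqOpBound_transferRay hC1 k (hC n k) (hq n k).1 (hq n k).2⟩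

/-- Off a set `S` of nodes where the coefficient `γ` may be large, the iteration matrix is the sum of
a matrix with a small spectral norm and a matrix with a controlled Frobenius norm. -/
theorem exists_decomposition (hΦ : Q.KernelRiemann) (hw : BoundedWeights G)
    (hT : UniformInterpolation G) (hstep : QuasiUniformSteps G) (hopt : TightOpticalLength G)
    (cγ : ℝ) {ε : ℝ} (hε : 0 < ε) :
    ∃ K : ℝ, 0 ≤ K ∧ ∀ n (S : Set (Fin (G n).Ns × Fin (G n).Nr)),
      (∀ a ∉ S, |Q.γ ((G n).x a.1) ((G n).r a.2)| ≤ cγ) → ∃ R E,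
        (G n).Lam * (G n).Sig = R + E + (G n).Lam * restrictRows S (G n).Sig ∧
        SqOpBound E (ε ^ 2) ∧ ∀ l : ℝ, 0 ≤ l → (∀ k, ((G n).L k : ℝ) ≤ l) → frobSq R ≤ K * l := by
  classical
  obtain ⟨cΛ, hcΛ0, hΛ⟩ := exists_sqOpBound_Lam hT hstep
  obtain ⟨q, hq⟩ := hT
  obtain ⟨C, hC1, hC⟩ := exists_ratio_bound hstep
  obtain ⟨-, cΦ, hcΦ⟩ := hΦ
  obtain ⟨cw, hcw⟩ := hw
  set c := |cγ| * |cΦ| * |cw| with hc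
  have hc0 : 0 ≤ c := by positivity
  -- Admissible fraction of rays with long characteristics: it gives `cΛ * (c * (η * c)) ≤ ε ^ 2`.
  -- The summand `1` keeps the denominator positive.
  set η := ε ^ 2 / (cΛ * c ^ 2 + 1) with hη
  have hη0 : 0 < η := by positivity
  obtain ⟨T, hT⟩ := hopt η hη0
  refine ⟨c ^ 2 * ((q : ℝ) ^ 6 * (4 * C ^ 4 * T ^ 2)), by positivity, fun n S hS => ?_⟩
  set P := {k | ∃ ℓ, T < (G n).opticalLength k ℓ} with hP
  have hSig : ∀ a ∉ S, ∀ b, |(G n).Sig a b| ≤ if a.1 = b.1 then c / (G n).Nr else 0 :=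
    fun a ha b => (G n).abs_Sig_le (abs_nonneg cγ) (abs_nonneg cΦ)
      (fun x hx r hr r' hr' => (hcΦ x hx r hr r' hr').trans (le_abs_self _))
      (fun k => (hcw n k).trans (le_abs_self _)) ((hS a ha).trans (le_abs_self _)) b
  have hrestr : ∀ U : Set (Fin (G n).Ns × Fin (G n).Nr), U ⊆ Sᶜ → ∀ a b,
      |restrictRows U (G n).Sig a b| ≤ if a.1 = b.1 then c / (G n).Nr else 0 := by
    intro U hU a b
    by_cases ha : a ∈ U
    · rw [restrictRows_of_mem _ ha]
      exact hSig a (hU ha) b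
    · rw [restrictRows_of_notMem _ ha, abs_zero]
      positivity
  -- Off `S`, the rays whose characteristics all have optical length at most `T` go to `X` and yield
  -- `R`; the few other rays go to `Y` and yield `E`.
  set X := restrictRows (Sᶜ ∩ {a | a.2 ∉ P}) (G n).Sig with hX
  set Y := restrictRows (Sᶜ ∩ {a | a.2 ∈ P}) (G n).Sig with hY
  refine ⟨(G n).Lam * X, (G n).Lam * Y, ?_, ?_, fun l hl hL => ?_⟩
  · rw [← mul_add, ← mul_add]
    congr 1
    ext a b
    by_cases h1 : a ∈ S <;> by_cases h2 : a.2 ∈ P <;> simp [hX, hY, restrictRows, h1, h2]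
  · refine ((hΛ n).mul (sqOpBound_of_couples_rays hc0 (hrestr _ Set.inter_subset_left) (S := P)
      (fun a b ha => restrictRows_of_notMem _ (fun h => ha h.2) b) hη0.le (hT n)) hcΛ0).mono ?_
    rw [hη]
    have : cΛ * (c * (ε ^ 2 / (cΛ * c ^ 2 + 1) * c)) = ε ^ 2 * (cΛ * c ^ 2 / (cΛ * c ^ 2 + 1)) := by
      ring
    rw [this]
    exact mul_le_of_le_one_right (by positivity) (div_le_one_of_le₀ (by linarith) (by positivity))
  · rw [mul_assoc (c ^ 2)]
    refine frobSq_blockDiagonal_mul_le (S := {k | k ∉ P}) (hrestr _ Set.inter_subset_left)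
      (by positivity) (fun k hk => ?_)
      (fun a b ha => restrictRows_of_notMem _ (fun h => ha h.2) b)
    have hk' : ∀ ℓ, (G n).opticalLength k ℓ ≤ T := fun ℓ => not_lt.1 fun h => hk ⟨ℓ, h⟩
    refine ((G n).frobSq_transferRay_le hC1 k (hC n k) (hq n k).1 (hq n k).2 hk').trans ?_
    have := hL k
    gcongr

/-- The decomposition for a coefficient `γ` that is bounded off sets with few nodes. -/
theorem eventually_decomposition (hΦ : Q.KernelRiemann) (hw : BoundedWeights G)
    (hT : UniformInterpolation G) (hstep : QuasiUniformSteps G) (hopt : TightOpticalLength G)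
    (hchar : FewCharacteristics G) {ε η : ℝ} (hε : 0 < ε) (hη : 0 < η)
    (hγ : ∃ (B : Set (Fin d ⊕ Fin m → ℝ)) (c : ℝ),
      (∀ x ∈ Q.D, ∀ r ∈ Q.R, Sum.elim x r ∉ B → |Q.γ x r| ≤ c) ∧
      ∀ᶠ n in atTop, ({a : Fin (G n).Ns × Fin (G n).Nr |
        Sum.elim ((G n).x a.1) ((G n).r a.2) ∈ B}.ncard : ℝ) ≤ η * (G n).N) :
    ∀ᶠ n in atTop, ∃ R E S, (G n).Lam * (G n).Sig = R + E + (G n).Lam * restrictRows S (G n).Sig ∧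
      SqOpBound E (ε ^ 2) ∧ frobSq R ≤ η * (G n).N ∧ (S.ncard : ℝ) ≤ η * (G n).N := by
  obtain ⟨B, c, hc, hB⟩ := hγ
  obtain ⟨K, hK0, hK⟩ := exists_decomposition hΦ hw hT hstep hopt c hε
  -- The denominator `K + 1` also covers `K = 0`; what is needed is `K / (K + 1) ≤ 1`.
  filter_upwards [hB, hchar (η / (K + 1)) (by positivity)] with n hBn hLn
  obtain ⟨R, E, h1, h2, h3⟩ := hK n
    {a | Sum.elim ((G n).x a.1) ((G n).r a.2) ∈ B}
    fun a ha => hc _ ((G n).x_mem _) _ ((G n).r_mem _) ha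
  refine ⟨R, E, _, h1, h2, (h3 _ (by positivity) hLn).trans ?_, hBn⟩
  have : K * (η / (K + 1) * (G n).N) = K / (K + 1) * (η * (G n).N) := by ring
  rw [this]
  exact mul_le_of_le_one_left (by positivity) (div_le_one_of_le₀ (by linarith) (by positivity))

theorem RTGrid.card_eq_N (G : RTGrid Q) : Fintype.card (Fin G.Ns × Fin G.Nr) = G.N := by
  simp [RTGrid.N]

/-- The rows at `S` form a matrix of rank at most `S.ncard`, and multiplication by $\Lambda_N$ does
not increase the rank. The cases `s = 1` and `s = 0` serve $A_N$ and $A_N-Id_N$. -/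
theorem weakSingCluster_smul_one_sub {s : ℝ} (hs : 0 ≤ s)
    (h : ∀ ε : ℝ, 0 < ε → ∀ η : ℝ, 0 < η → ∀ᶠ n in atTop, ∃ R E S,
      (G n).Lam * (G n).Sig = R + E + (G n).Lam * restrictRows S (G n).Sig ∧
      SqOpBound E (ε ^ 2) ∧ frobSq R ≤ η * (G n).N ∧ (S.ncard : ℝ) ≤ η * (G n).N) :
    WeakSingCluster (fun n => (s • (1 : Matrix (Fin (G n).Ns × Fin (G n).Nr) _ ℝ) -
      (G n).Lam * (G n).Sig).map Complex.ofReal) s := by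
  refine weakSingCluster_of_decomposition hs fun ε hε η hη => ?_
  filter_upwards [h ε hε η hη] with n hn
  obtain ⟨R, E, S, h1, hE, hR, hS⟩ := hn
  refine ⟨-R, -E, -((G n).Lam * restrictRows S (G n).Sig), by rw [h1]; abel, hE.neg, ?_, ?_⟩
  · rwa [frobSq_neg, RTGrid.card_eq_N]
  · rw [RTGrid.card_eq_N]
    refine le_trans ?_ hS
    have h2 : (-((G n).Lam * restrictRows S (G n).Sig)).map Complex.ofReal =
        (-(G n).Lam).map Complex.ofReal * (restrictRows S (G n).Sig).map Complex.ofReal := by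
      rw [← neg_mul]
      exact Matrix.map_mul (f := Complex.ofRealHom)
    rw [h2]
    exact_mod_cast (Matrix.rank_mul_le_right _ _).trans (rank_map_restrictRows_le _ _)

theorem weakEigCluster_smul_one_sub (s : ℝ)
    (h : ∀ ε : ℝ, 0 < ε → ∀ η : ℝ, 0 < η → ∀ᶠ n in atTop, ∃ R E,
      (G n).Lam * (G n).Sig = R + E ∧ SqOpBound E (ε ^ 2) ∧ frobSq R ≤ η * (G n).N) :
    WeakEigCluster (fun n => (s • (1 : Matrix (Fin (G n).Ns × Fin (G n).Nr) _ ℝ) -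
      (G n).Lam * (G n).Sig).map Complex.ofReal) s := by
  refine weakEigCluster_of_decomposition fun ε hε η hη => ?_
  filter_upwards [h ε hε η hη] with n hn
  obtain ⟨R, E, h1, hE, hR⟩ := hn
  refine ⟨-R, -E, by rw [h1]; abel, hE.neg, ?_⟩
  rwa [frobSq_neg, RTGrid.card_eq_N]

theorem frobSq_add_le {α β : Type*} [Fintype α] [Fintype β] (A B : Matrix α β ℝ) :
    frobSq (A + B) ≤ 2 * (frobSq A + frobSq B) := by
  simp only [frobSq, ← Finset.sum_add_distrib, Finset.mul_sum]
  refine Finset.sum_le_sum fun i _ => Finset.sum_le_sum fun j _ => ?_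
  rw [Matrix.add_apply]
  nlinarith [sq_nonneg (A i j - B i j)]

/-- A spectral bound on $\Sigma_N$ bounds each of its rows, even where $\gamma$ is large. Few rows
then have a squared Frobenius norm that is small relative to $N$, so the low rank term can be
absorbed into `R`. -/
theorem eventually_decomposition_of_boundedScattering (hT : UniformInterpolation G)
    (hstep : QuasiUniformSteps G) (hsc : BoundedScattering G)
    (h : ∀ ε : ℝ, 0 < ε → ∀ η : ℝ, 0 < η → ∀ᶠ n in atTop, ∃ R E S,
      (G n).Lam * (G n).Sig = R + E + (G n).Lam * restrictRows S (G n).Sig ∧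
      SqOpBound E (ε ^ 2) ∧ frobSq R ≤ η * (G n).N ∧ (S.ncard : ℝ) ≤ η * (G n).N)
    (ε : ℝ) (hε : 0 < ε) (η : ℝ) (hη : 0 < η) : ∀ᶠ n in atTop, ∃ R E,
      (G n).Lam * (G n).Sig = R + E ∧ SqOpBound E (ε ^ 2) ∧ frobSq R ≤ η * (G n).N := by
  obtain ⟨c, hc0, hc⟩ := exists_sqOpBound_Lam hT hstep
  obtain ⟨C, hC⟩ := hsc
  filter_upwards [h ε hε (η / (2 * (1 + c * C ^ 2))) (by positivity)] with n hn
  obtain ⟨R, E, S, h1, hE, hR, hS⟩ := hn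
  refine ⟨R + (G n).Lam * restrictRows S (G n).Sig, E, by rw [h1]; abel, hE, ?_⟩
  have h2 : frobSq ((G n).Lam * restrictRows S (G n).Sig) ≤
      c * (C ^ 2 * (η / (2 * (1 + c * C ^ 2)) * (G n).N)) := by
    refine (frobSq_mul_le_mul_frobSq (hc n) _).trans ?_
    have := frobSq_restrictRows_le S ((G n).sqOpBound_Sig (hC n)) (sq_nonneg C)
    gcongr
    exact this.trans (by gcongr)
  refine (frobSq_add_le _ _).trans ((mul_le_mul_of_nonneg_left (add_le_add hR h2)
    zero_le_two).trans (le_of_eq ?_))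
  field_simp

/-- Generalized integrability bounds $\gamma$ off a set of small volume, and nonconcentration
converts small volume into a small fraction of the nodes. -/
theorem exists_bound_off_small_set (hγ : Q.GammaGenRiemann) (hG : NonconcentratingNodes G) (η : ℝ)
    (hη : 0 < η) : ∃ (B : Set (Fin d ⊕ Fin m → ℝ)) (c : ℝ),
      (∀ x ∈ Q.D, ∀ r ∈ Q.R, Sum.elim x r ∉ B → |Q.γ x r| ≤ c) ∧
      ∀ᶠ n in atTop, ({a : Fin (G n).Ns × Fin (G n).Nr |
        Sum.elim ((G n).x a.1) ((G n).r a.2) ∈ B}.ncard : ℝ) ≤ η * (G n).N := by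
  obtain ⟨δ, hδ, h⟩ := hG η hη
  obtain ⟨B, hB, hBJ, hvol, ⟨c, hc⟩, -⟩ := hγ δ hδ
  refine ⟨B, c, fun x hx r hr hxr => ?_, h B hB hBJ hvol⟩
  have := hc (Sum.elim x r) ⟨⟨by simpa using hx, by simpa using hr⟩, hxr⟩
  simpa using this

theorem RTGrid.A_eq (G : RTGrid Q) : G.A =
    ((1 : ℝ) • (1 : Matrix (Fin G.Ns × Fin G.Nr) _ ℝ) - G.Lam * G.Sig).map Complex.ofReal := by
  rw [one_smul, RTGrid.A]

theorem RTGrid.A_sub_one_eq (G : RTGrid Q) : G.A - 1 =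
    ((0 : ℝ) • (1 : Matrix (Fin G.Ns × Fin G.Nr) _ ℝ) - G.Lam * G.Sig).map Complex.ofReal := by
  ext a b
  by_cases h : a = b <;> simp [RTGrid.A, h]

end Decomposition

/-! ### The main theorem. -/

theorem mainTheorem1 {d m : ℕ} (Q : RTProblem d m) (G : ℕ → RTGrid Q)
    (hN : Tendsto (fun n => (G n).N) atTop atTop)
    (hΦ : Q.KernelRiemann)
    (hw : BoundedWeights G)
    (hT : UniformInterpolation G)
    (hstep : QuasiUniformSteps G)
    (hopt : TightOpticalLength G)
    (hchar : FewCharacteristics G) :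
    -- possibly unbounded `γ`
    (Q.GammaGenRiemann → NonconcentratingNodes G →
      SingDistributedConst (fun n => (G n).A - 1) 0 ∧
      WeakSingCluster (fun n => (G n).A) 1 ∧
      (BoundedScattering G →
        EigDistributedConst (fun n => (G n).A - 1) 0 ∧
        WeakEigCluster (fun n => (G n).A) 1)) ∧
    -- bounded `γ`
    (Q.GammaBounded →
      SingDistributedConst (fun n => (G n).A - 1) 0 ∧
      EigDistributedConst (fun n => (G n).A - 1) 0 ∧
      WeakSingCluster (fun n => (G n).A) 1 ∧
      WeakEigCluster (fun n => (G n).A) 1 ∧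
      (BoundedCharacteristics G →
        StrongEigCluster (fun n => (G n).A) 1 ∧
        StrongSingCluster (fun n => (G n).A) 1)) := by
  have hN' : Tendsto (fun n => Fintype.card (Fin (G n).Ns × Fin (G n).Nr)) atTop atTop := by
    simpa only [RTGrid.card_eq_N] using hN
  simp only [RTGrid.A_sub_one_eq]
  simp only [RTGrid.A_eq]
  refine ⟨fun hγ hG => ?_, fun ⟨c, hc⟩ => ?_⟩
  · have hdec := fun ε (hε : 0 < ε) η (hη : 0 < η) => eventually_decomposition hΦ hw hT hstep hopt
      hchar hε hη (exists_bound_off_small_set hγ hG η hη)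
    refine ⟨(weakSingCluster_smul_one_sub le_rfl hdec).singDistributedConst hN',
      weakSingCluster_smul_one_sub zero_le_one hdec, fun hsc => ?_⟩
    have hdec' := eventually_decomposition_of_boundedScattering hT hstep hsc hdec
    have h0 := weakEigCluster_smul_one_sub 0 hdec'
    have h1 := weakEigCluster_smul_one_sub 1 hdec'
    rw [Complex.ofReal_zero] at h0
    rw [Complex.ofReal_one] at h1
    exact ⟨h0.eigDistributedConst hN', h1⟩
  -- For bounded $\gamma$ the exceptional set is empty: no low rank term appears, and the
  -- decomposition holds for every `n` with one constant `K`.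
  · have hstrong : ∀ ε : ℝ, 0 < ε → ∃ K : ℝ, 0 ≤ K ∧ ∀ n, ∃ R E,
        (G n).Lam * (G n).Sig = R + E ∧ SqOpBound E (ε ^ 2) ∧
        ∀ l : ℝ, 0 ≤ l → (∀ k, ((G n).L k : ℝ) ≤ l) → frobSq R ≤ K * l := by
      intro ε hε
      obtain ⟨K, hK0, hK⟩ := exists_decomposition hΦ hw hT hstep hopt c hε
      refine ⟨K, hK0, fun n => ?_⟩
      obtain ⟨R, E, h1, h2⟩ := hK n ∅ fun a _ => hc _ ((G n).x_mem _) _ ((G n).r_mem _)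
      refine ⟨R, E, ?_, h2⟩
      have h0 : restrictRows ∅ (G n).Sig = 0 := by
        ext a b
        exact restrictRows_of_notMem _ (Set.notMem_empty a) b
      rw [h1, h0, mul_zero, add_zero]
    have hweak : ∀ ε : ℝ, 0 < ε → ∀ η : ℝ, 0 < η → ∀ᶠ n in atTop, ∃ R E,
        (G n).Lam * (G n).Sig = R + E ∧ SqOpBound E (ε ^ 2) ∧ frobSq R ≤ η * (G n).N := by
      intro ε hε η hη
      obtain ⟨K, hK0, hK⟩ := hstrong ε hε
      filter_upwards [hchar (η / (K + 1)) (by positivity)] with n hn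
      obtain ⟨R, E, h1, hE, hR⟩ := hK n
      refine ⟨R, E, h1, hE, (hR _ (by positivity) hn).trans ?_⟩
      have : K * (η / (K + 1) * (G n).N) = K / (K + 1) * (η * (G n).N) := by ring
      rw [this]
      exact mul_le_of_le_one_left (by positivity)
        (div_le_one_of_le₀ (by linarith) (by positivity))
    have hdec := fun ε (hε : 0 < ε) η (hη : 0 < η) => eventually_decomposition hΦ hw hT hstep hopt
      hchar hε hη ⟨∅, c, fun x hx r hr _ => hc x hx r hr, Eventually.of_forall fun n => by
        simp only [Set.mem_empty_iff_false, Set.ofPred_false, Set.ncard_empty, Nat.cast_zero]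
        positivity⟩
    have h0 := weakEigCluster_smul_one_sub 0 hweak
    have h1 := weakEigCluster_smul_one_sub 1 hweak
    rw [Complex.ofReal_zero] at h0
    rw [Complex.ofReal_one] at h1
    refine ⟨(weakSingCluster_smul_one_sub le_rfl hdec).singDistributedConst hN',
      h0.eigDistributedConst hN', weakSingCluster_smul_one_sub zero_le_one hdec, h1, ?_⟩
    rintro ⟨l, hl⟩
    have hstrong' : ∀ ε : ℝ, 0 < ε → ∃ K : ℝ, ∀ n, ∃ R E,
        (1 : ℝ) • (1 : Matrix (Fin (G n).Ns × Fin (G n).Nr) (Fin (G n).Ns × Fin (G n).Nr) ℝ) -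
          (G n).Lam * (G n).Sig = (1 : ℝ) • 1 + R + E ∧
        SqOpBound E (ε ^ 2) ∧ frobSq R ≤ K := by
      intro ε hε
      obtain ⟨K, -, hK⟩ := hstrong ε hε
      refine ⟨K * l, fun n => ?_⟩
      obtain ⟨R, E, h1, hE, hR⟩ := hK n
      refine ⟨-R, -E, by rw [h1]; abel, hE.neg, ?_⟩
      rw [frobSq_neg]
      exact hR l (Nat.cast_nonneg l) fun k => by exact_mod_cast hl n k
    have h2 := strongEigCluster_of_decomposition hstrong'
    rw [Complex.ofReal_one] at h2
    exact ⟨h2, strongSingCluster_of_decomposition zero_le_one hstrong'⟩
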